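/- Let $p$ be fixed and let $Y_1,Y_2,\dots$ be i.i.d. $N(0,\Sigma_0)$ random vectors in $\mathbb{R}^p$, where $\Sigma_0$ is symmetric positive definite. A clique model $\mathcal M$ is a partition of $\{1,\dots,p\}$ into nonempty cliques $c_1,\dots,c_k$, of sizes $g_1,\dots,g_k$. For a $p\times p$ matrix $S$ let $S^{\mathcal M}$ be obtained from $S$ by setting to zero all entries whose two indices are not in the same clique of $\mathcal M$, and call $\mathcal M$ compatible (with $\Sigma_0$) if $\Sigma_0^{\mathcal M}=\Sigma_0$. Let $\mathcal M_0$ be the true clique model: $\mathcal M_0$ is compatible, and every compatible clique model is obtained by merging cliques of $\mathcal M_0$. For data $y=(y_1,\dots,y_n)$ put $S_n=\frac1n\sum_{i=1}^n y_iy_i^T$, and let the generalized fiducial probability of a clique model be $$ r(\mathcal M\mid y)\;\propto\;\frac{\pi^{\frac12\sum_{i=1}^k g_i^2}}{|\det S_n^{\mathcal M}|^{n/2}}\prod_{i=1}^k C_{\mathcal M,i}(y)\,\frac{\Gamma_{g_i}(n/2)}{\Gamma_{g_i}(g_i/2)},\qquad \Gamma_g(x)=\pi^{g(g-1)/4}\prod_{j=1}^g\Gamma\Big(x+\frac{1-j}2\Big),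 $$ where either ($l_2$ norm) $C_{\mathcal M,i}(y)=|\det S_n^{\mathcal M,i}|^{g_i/2}$ for every $\mathcal M$ and $i$, with $S_n^{\mathcal M,i}$ the block of $S_n$ indexed by $c_i$, or ($l_\infty$ norm) $C_{\mathcal M,i}(y)=\Big(\binom n{g_i}^{-1}\sum_{1\le j_1<\dots<j_{g_i}\le n}\big|\det (y_{j_s,a})_{s\le g_i,\,a\in c_i}\big|\Big)^{g_i}$ for every $\mathcal M$ and $i$. Let $q_{\mathcal M}(n)\ge 0$ be penalties with $q_{\mathcal M_0}(n)>0$, and let $$ r_p(\mathcal M\mid y)=\frac{r(\mathcal M\mid y)\,q_{\mathcal M}(n)}{\sum_{\mathcal M'} r(\mathcal M'\mid y)\,q_{\mathcal M'}(n)}, $$ the sum being over all clique models on $\{1,\dots,p\}$. Assume that for every clique model $\mathcal M$ that is not compatible (so that $\det\Sigma_0<\det\Sigma_0^{\mathcal M}$) one has $e^{-an}q_{\mathcal M}(n)/q_{\mathcal M_0}(n)\to0$ as $n\to\infty$ for all $a>0$, and that for every compatible clique model $\mathcal M$ the ratio $q_{\mathcal M}(n)/q_{\mathcal M_0}(n)$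 is bounded in $n$. Then, under either choice of norm, $r_p(\mathcal M_0\mid Y_1,\dots,Y_n)\to1$ in probability as $n\to\infty$. -/

import Mathlib

open MeasureTheory ProbabilityTheory Filter Topology

noncomputable section

namespace CliqueGFD

/-- A clique model on the coordinates `1, …, p`: a partition of the index set into nonempty cliques.
`M₁ ≤ M₂` means that the cliques of `M₂` are obtained by merging cliques of `M₁`. -/
abbrev CliqueModel (p : ℕ) : Type := Finpartition (Finset.univ : Finset (Fin p))

/-- The matrix obtained from `S` by setting to zero all entries whose two indices do not lie in the
same clique of `M`. -/
def cliqueTruncation {p : ℕ} (M : CliqueModel p) (S : Matrix (Fin p) (Fin p) ℝ) :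
    Matrix (Fin p) (Fin p) ℝ :=
  Matrix.of fun a b => open Classical in if ∃ c ∈ M.parts, a ∈ c ∧ b ∈ c then S a b else 0

/-- `M` is compatible with the covariance matrix `S`. -/
def Compatible {p : ℕ} (M : CliqueModel p) (S : Matrix (Fin p) (Fin p) ℝ) : Prop :=
  cliqueTruncation M S = S

/-- The (uncentred) sample covariance `Sₙ = (1/n) ∑ yᵢ yᵢᵀ`; the rows of the data matrix `y` are the
observations. -/
def sampleCov {n p : ℕ} (y : Matrix (Fin n) (Fin p) ℝ) : Matrix (Fin p) (Fin p) ℝ :=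
  Matrix.of fun a b => (∑ i, y i a * y i b) / (n : ℝ)

/-- The diagonal block of `S` belonging to the clique `c`. -/
def cliqueBlock {p : ℕ} (c : Finset (Fin p)) (S : Matrix (Fin p) (Fin p) ℝ) : Matrix c c ℝ :=
  S.submatrix (fun a => (a : Fin p)) (fun b => (b : Fin p))

/-- The choice of norm in the fiducial Jacobian. -/
inductive JacobianNorm
  | l2
  | linf

/-- The Jacobian constant computed from the coordinates in the clique `c`, of size `g = #c`.
For the `l₂` norm it is `|det Sₙᶜ| ^ (g / 2)`; for the `l_∞` norm it is the `g`-th power of the average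
of `|det|` over all choices of `g` rows `f 0 < f 1 < ⋯` of the columns of `y` indexed by `c`. -/
def jacobianConst (N : JacobianNorm) {n p : ℕ} (y : Matrix (Fin n) (Fin p) ℝ)
    (c : Finset (Fin p)) : ℝ :=
  match N with
  | .l2 => |(cliqueBlock c (sampleCov y)).det| ^ ((c.card : ℝ) / 2)
  | .linf =>
    ((n.choose c.card : ℝ)⁻¹ *
      ∑ f : Fin c.card → Fin n, open Classical in
        if StrictMono f then |(y.submatrix f (c.orderEmbOfFin rfl)).det| else 0) ^ c.card

/-- The multivariate gamma function
`Γ_g(x) = π ^ (g (g - 1) / 4) ∏_{j = 1}^g Γ(x + (1 - j) / 2)`. -/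
def multivariateGamma (g : ℕ) (x : ℝ) : ℝ :=
  Real.pi ^ ((g : ℝ) * ((g : ℝ) - 1) / 4) *
    ∏ j ∈ Finset.Icc 1 g, Real.Gamma (x + (1 - (j : ℝ)) / 2)

/-- The unnormalized generalized fiducial probability of the clique model `M` given the data. -/
def gfdWeight (N : JacobianNorm) {n p : ℕ} (M : CliqueModel p) (y : Matrix (Fin n) (Fin p) ℝ) : ℝ :=
  Real.pi ^ ((∑ c ∈ M.parts, (c.card : ℝ) ^ 2) / 2) /
      |(cliqueTruncation M (sampleCov y)).det| ^ ((n : ℝ) / 2) *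
    ∏ c ∈ M.parts, jacobianConst N y c *
      (multivariateGamma c.card ((n : ℝ) / 2) / multivariateGamma c.card ((c.card : ℝ) / 2))

/-- The penalized generalized fiducial probability of the clique model `M` given the data,
normalized to have total mass one over all clique models. -/
def penalizedGFD (N : JacobianNorm) {n p : ℕ} (q : CliqueModel p → ℕ → ℝ) (M : CliqueModel p)
    (y : Matrix (Fin n) (Fin p) ℝ) : ℝ :=
  gfdWeight N M y * q M n / ∑ M' : CliqueModel p, gfdWeight N M' y * q M' n

/-- The data matrix whose rows are the first `n` observations. -/
def dataMatrix {p : ℕ} {Ω : Type*} (Y : ℕ → Ω → EuclideanSpace ℝ (Fin p)) (n : ℕ) (ω : Ω) :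
    Matrix (Fin n) (Fin p) ℝ :=
  Matrix.of fun i a => Y i ω a

end CliqueGFD

end

/-! Divide by the weight of `M₀`: it is enough that each ratio r(M)q_M / (r(M₀)q_{M₀}) with M ≠ M₀
tends to 0 in probability, since there are finitely many models. Such a ratio is a constant times
the likelihood ratio (det S^{M₀} / det S^M)^{n/2}, a ratio of Jacobian constants, a ratio of
multivariate gamma functions and the penalty ratio. By log-convexity of Γ, the gamma ratio has order
(n/2)^{-β} with β = α(M) - α(M₀) and α = ∑ g(g-1)/4. The Jacobian constants stay bounded above and
away from 0 in probability.

If M is not compatible, the strict Fischer inequality gives det Σ₀ < det Σ₀^M. The likelihood ratio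
then decays exponentially, which beats every power of n and the penalty.

If M is compatible and M ≠ M₀, it merges cliques of M₀, so β > 0. Put A = S^M, D = S^{M₀}, E = A -
D. Then det D / det A ≤ exp tr(E A⁻¹ E D⁻¹), which is quadratic in entries whose limits vanish.
These entries are o(√(log n / n)) in probability by Chebyshev, so the likelihood ratio is eventually
at most (n/2)^{β/2}, and the gamma factor wins.

The delicate point is the lower bound on the l_∞ constant, an average of |det| over subsets of rows.
Shrinking each observation by 1/(1 + ‖Y‖) makes all entries at most 1. Cauchy–Binet then bounds the
average below by a determinant of a second moment matrix of bounded vectors, to which the ordinary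
law of large numbers applies.

Convergence in probability is encoded as convergence along a filter on pairs (n, ω), so the
asymptotic argument is carried out with ordinary limits. -/

namespace Matrix

/-! ### Determinant and trace inequalities for positive definite matrices -/

variable {ι : Type*} [Fintype ι] [DecidableEq ι]

theorem IsHermitian.eq_one_of_eigenvalues_eq_one {H : Matrix ι ι ℝ} (hH : H.IsHermitian)
    (h : ∀ i, hH.eigenvalues i = 1) : H = 1 := by
  have := hH.spectral_theorem
  rw [this]
  have : (RCLike.ofReal ∘ hH.eigenvalues : ι → ℝ) = fun _ => 1 := by
    ext i; simp [h]
  rw [this, Matrix.diagonal_one, map_one]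

/-- Multiply λ ≤ exp(λ - 1) over the eigenvalues; equality forces every λ = 1, whence the strict
version below. -/
theorem PosDef.det_le_exp_trace_sub_card {H : Matrix ι ι ℝ} (hH : H.PosDef) :
    H.det ≤ Real.exp (H.trace - Fintype.card ι) := by
  rw [hH.isHermitian.det_eq_prod_eigenvalues, hH.isHermitian.trace_eq_sum_eigenvalues]
  have : (∑ i, (hH.isHermitian.eigenvalues i : ℝ)) - Fintype.card ι
      = ∑ i, (hH.isHermitian.eigenvalues i - 1) := by
    simp [Finset.sum_sub_distrib]
  simp only [RCLike.ofReal_real_eq_id, id] at this ⊢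
  rw [this, Real.exp_sum]
  refine Finset.prod_le_prod (fun i _ => (hH.eigenvalues_pos i).le) fun i _ => ?_
  have := Real.add_one_le_exp (hH.isHermitian.eigenvalues i - 1)
  linarith

theorem PosDef.det_lt_exp_trace_sub_card {H : Matrix ι ι ℝ} (hH : H.PosDef) (h1 : H ≠ 1) :
    H.det < Real.exp (H.trace - Fintype.card ι) := by
  rw [hH.isHermitian.det_eq_prod_eigenvalues, hH.isHermitian.trace_eq_sum_eigenvalues]
  have : (∑ i, (hH.isHermitian.eigenvalues i : ℝ)) - Fintype.card ι
      = ∑ i, (hH.isHermitian.eigenvalues i - 1) := by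
    simp [Finset.sum_sub_distrib]
  simp only [RCLike.ofReal_real_eq_id, id] at this ⊢
  rw [this, Real.exp_sum]
  obtain ⟨i, hi⟩ : ∃ i, hH.isHermitian.eigenvalues i ≠ 1 := by
    by_contra! h
    exact h1 (hH.isHermitian.eq_one_of_eigenvalues_eq_one h)
  refine Finset.prod_lt_prod (fun i _ => hH.eigenvalues_pos i) (fun i _ => ?_)
    ⟨i, Finset.mem_univ _, ?_⟩
  · have := Real.add_one_le_exp (hH.isHermitian.eigenvalues i - 1)
    linarith
  · have := Real.add_one_lt_exp (sub_ne_zero.2 hi)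
    linarith

theorem PosDef.exists_inv_eq_conjTranspose_mul_self {C : Matrix ι ι ℝ} (hC : C.PosDef) :
    ∃ L : Matrix ι ι ℝ, IsUnit L ∧ C⁻¹ = Lᴴ * L := by
  open scoped MatrixOrder in
  obtain ⟨L, hL⟩ := CStarAlgebra.nonneg_iff_eq_star_mul_self.1 hC.inv.posSemidef.nonneg
  refine ⟨L, ?_, hL⟩
  rw [Matrix.isUnit_iff_isUnit_det, isUnit_iff_ne_zero]
  intro h0
  have := hC.inv.det_pos
  rw [hL, Matrix.star_eq_conjTranspose, Matrix.det_mul, h0, mul_zero] at this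
  exact lt_irrefl _ this

/-- With C⁻¹ = LᴴL, the matrix L B Lᴴ has determinant det B / det C and trace tr(B C⁻¹), which
reduces to the case C = 1. -/
theorem PosDef.det_div_det_le_exp {B C : Matrix ι ι ℝ} (hB : B.PosDef) (hC : C.PosDef) :
    B.det / C.det ≤ Real.exp ((B * C⁻¹).trace - Fintype.card ι) := by
  obtain ⟨L, hL, hLC⟩ := hC.exists_inv_eq_conjTranspose_mul_self
  have hH : (L * B * Lᴴ).PosDef := (Matrix.IsUnit.posDef_star_right_conjugate_iff hL).2 hB
  have h1 := hH.det_le_exp_trace_sub_card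
  have h2 : (L * B * Lᴴ).trace = (B * C⁻¹).trace := by
    rw [Matrix.mul_assoc, Matrix.trace_mul_comm, hLC, Matrix.mul_assoc]
  have h3 : (L * B * Lᴴ).det = B.det / C.det := by
    have : C.det⁻¹ = (Lᴴ).det * L.det := by
      rw [← Matrix.det_mul, ← hLC, Matrix.det_nonsing_inv, Ring.inverse_eq_inv']
    rw [Matrix.det_mul, Matrix.det_mul, div_eq_mul_inv, this]; ring
  rwa [h2, h3] at h1

theorem PosDef.det_lt_det_of_trace_eq {B C : Matrix ι ι ℝ} (hB : B.PosDef) (hC : C.PosDef)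
    (htr : (B * C⁻¹).trace = Fintype.card ι) (hne : B ≠ C) : B.det < C.det := by
  obtain ⟨L, hL, hLC⟩ := hC.exists_inv_eq_conjTranspose_mul_self
  have hH : (L * B * Lᴴ).PosDef := (Matrix.IsUnit.posDef_star_right_conjugate_iff hL).2 hB
  have hLu : IsUnit L.det := (Matrix.isUnit_iff_isUnit_det L).1 hL
  have hLu' : IsUnit (Lᴴ).det := by rw [Matrix.det_conjTranspose]; exact hLu.star
  have hC' : C = L⁻¹ * Lᴴ⁻¹ := by
    rw [← Matrix.mul_inv_rev, ← hLC, Matrix.nonsing_inv_nonsing_inv _ hC.det_pos.ne'.isUnit]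
  have h1 := hH.det_lt_exp_trace_sub_card (fun h => hne (by
    calc B = L⁻¹ * (L * B * Lᴴ) * Lᴴ⁻¹ := by
            rw [Matrix.mul_assoc L, Matrix.nonsing_inv_mul_cancel_left _ _ hLu,
              Matrix.mul_nonsing_inv_cancel_right _ _ hLu']
      _ = C := by rw [h, Matrix.mul_one, hC']))
  have h2 : (L * B * Lᴴ).trace = (B * C⁻¹).trace := by
    rw [Matrix.mul_assoc, Matrix.trace_mul_comm, hLC, Matrix.mul_assoc]
  have h3 : (L * B * Lᴴ).det = B.det / C.det := by
    have : C.det⁻¹ = (Lᴴ).det * L.det := by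
      rw [← Matrix.det_mul, ← hLC, Matrix.det_nonsing_inv, Ring.inverse_eq_inv']
    rw [Matrix.det_mul, Matrix.det_mul, div_eq_mul_inv, this]; ring
  rw [h2, h3, htr, sub_self, Real.exp_zero, div_lt_one hC.det_pos] at h1
  exact h1

end Matrix

/-! ### Truncation to cliques and Fischer's inequality -/

namespace CliqueGFD

open Matrix

variable {p : ℕ}

theorem cliqueTruncation_apply (M : CliqueModel p) (S : Matrix (Fin p) (Fin p) ℝ) (a b : Fin p) :
    cliqueTruncation M S a b = if b ∈ M.part a then S a b else 0 := by
  simp only [cliqueTruncation, Matrix.of_apply, Finpartition.mem_part_iff_exists, and_comm]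

theorem mem_part_symm (M : CliqueModel p) {a b : Fin p} (h : b ∈ M.part a) : a ∈ M.part b := by
  rw [Finpartition.mem_part_iff_exists] at *
  obtain ⟨c, hc, h1, h2⟩ := h
  exact ⟨c, hc, h2, h1⟩

theorem part_eq_part (M : CliqueModel p) {a b : Fin p} (h : b ∈ M.part a) : M.part b = M.part a :=
  M.part_eq_of_mem (M.part_mem.2 (Finset.mem_univ a)) h

theorem part_subset_part {M M' : CliqueModel p} (h : M ≤ M') (a : Fin p) :
    M.part a ⊆ M'.part a := by
  obtain ⟨c, hc, hac⟩ := h (M.part_mem.2 (Finset.mem_univ a))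
  have ha : a ∈ c := hac (M.mem_part (Finset.mem_univ a))
  rw [M'.part_eq_of_mem hc ha]
  exact hac

theorem cliqueTruncation_one (M : CliqueModel p) : cliqueTruncation M 1 = 1 := by
  ext a b
  rw [cliqueTruncation_apply]
  rcases eq_or_ne a b with rfl | h
  · simp
  · simp [Matrix.one_apply_ne h]

theorem cliqueTruncation_cliqueTruncation (M : CliqueModel p) (S : Matrix (Fin p) (Fin p) ℝ) :
    cliqueTruncation M (cliqueTruncation M S) = cliqueTruncation M S := by
  ext a b
  simp only [cliqueTruncation_apply]
  split_ifs <;> rfl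

theorem cliqueTruncation_cliqueTruncation_of_le {M M' : CliqueModel p} (h : M ≤ M')
    (S : Matrix (Fin p) (Fin p) ℝ) :
    cliqueTruncation M (cliqueTruncation M' S) = cliqueTruncation M S := by
  ext a b
  simp only [cliqueTruncation_apply]
  split_ifs with h1 h2
  · rfl
  · exact absurd (part_subset_part h a h1) h2
  · rfl

theorem cliqueTruncation_sub (M : CliqueModel p) (A B : Matrix (Fin p) (Fin p) ℝ) :
    cliqueTruncation M (A - B) = cliqueTruncation M A - cliqueTruncation M B := by
  ext a b
  simp only [cliqueTruncation_apply, Matrix.sub_apply]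
  split_ifs <;> simp

/-- Block-diagonal matrices form an algebra over which truncation is linear, like a conditional
expectation. Inverses and traces of compatible matrices are handled through this identity. -/
theorem cliqueTruncation_mul {M : CliqueModel p} {D : Matrix (Fin p) (Fin p) ℝ}
    (hD : Compatible M D) (X : Matrix (Fin p) (Fin p) ℝ) :
    cliqueTruncation M (X * D) = cliqueTruncation M X * D := by
  ext a b
  rw [cliqueTruncation_apply, Matrix.mul_apply, Matrix.mul_apply]
  have hD' : ∀ c, D c b = if b ∈ M.part c then D c b else 0 := fun c => by
    rw [← cliqueTruncation_apply, hD]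
  split_ifs with h
  · refine Finset.sum_congr rfl fun c _ => ?_
    rw [hD' c, cliqueTruncation_apply]
    split_ifs with h1 h2 h2
    · rfl
    · exact absurd (by
        rw [← part_eq_part M h, part_eq_part M h1]
        exact M.mem_part (Finset.mem_univ c)) h2
    · simp
    · simp
  · symm
    refine Finset.sum_eq_zero fun c _ => ?_
    rw [hD' c, cliqueTruncation_apply]
    split_ifs with h1 h2 h2
    · exact absurd (by rwa [part_eq_part M h1] at h2) h
    all_goals simp

theorem Compatible.inv {M : CliqueModel p} {D : Matrix (Fin p) (Fin p) ℝ}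
    (hD : Compatible M D) (hdet : IsUnit D.det) : Compatible M D⁻¹ := by
  have h := cliqueTruncation_mul hD D⁻¹
  rw [Matrix.nonsing_inv_mul _ hdet, cliqueTruncation_one] at h
  unfold Compatible
  rw [← Matrix.mul_nonsing_inv_cancel_right D (cliqueTruncation M D⁻¹) hdet, ← h, Matrix.one_mul]

theorem trace_cliqueTruncation (M : CliqueModel p) (S : Matrix (Fin p) (Fin p) ℝ) :
    (cliqueTruncation M S).trace = S.trace := by
  simp [Matrix.trace, cliqueTruncation_apply]

theorem trace_mul_of_compatible {M : CliqueModel p} {D : Matrix (Fin p) (Fin p) ℝ}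
    (hD : Compatible M D) (E : Matrix (Fin p) (Fin p) ℝ) :
    (E * D).trace = (cliqueTruncation M E * D).trace := by
  rw [← cliqueTruncation_mul hD, trace_cliqueTruncation]

theorem compatible_cliqueTruncation (M : CliqueModel p) (S : Matrix (Fin p) (Fin p) ℝ) :
    Compatible M (cliqueTruncation M S) :=
  cliqueTruncation_cliqueTruncation M S

theorem posDef_cliqueTruncation (M : CliqueModel p) {S : Matrix (Fin p) (Fin p) ℝ}
    (hS : S.PosDef) : (cliqueTruncation M S).PosDef := by
  refine Matrix.PosDef.of_dotProduct_mulVec_pos ?_ fun x hx => ?_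
  · ext a b
    have h := hS.isHermitian.apply a b
    simp only [star_trivial] at h
    simp only [Matrix.conjTranspose_apply, star_trivial, cliqueTruncation_apply, h]
    exact if_congr ⟨mem_part_symm M, mem_part_symm M⟩ rfl rfl
  -- The quadratic form of the truncation is the sum over cliques of the form of S at the
  -- restriction of x to the clique.
  · have key : star x ⬝ᵥ cliqueTruncation M S *ᵥ x
        = ∑ c ∈ M.parts, star (fun a => if a ∈ c then x a else 0) ⬝ᵥ
            S *ᵥ (fun a => if a ∈ c then x a else 0) := by
      simp only [dotProduct, mulVec, Finset.mul_sum, star_trivial, Pi.star_apply]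
      rw [Finset.sum_comm (s := M.parts)]
      refine Finset.sum_congr rfl fun a _ => ?_
      rw [Finset.sum_comm (s := M.parts)]
      refine Finset.sum_congr rfl fun b _ => ?_
      have hpa : M.part a ∈ M.parts := M.part_mem.2 (Finset.mem_univ a)
      rw [Finset.sum_eq_single_of_mem _ hpa]
      · rw [cliqueTruncation_apply, if_pos (M.mem_part (Finset.mem_univ a))]
        split_ifs <;> simp
      · intro c hc hne
        rw [if_neg, zero_mul]
        exact fun hac => hne (M.part_eq_of_mem hc hac).symm
    rw [key]
    obtain ⟨a, ha⟩ := Function.ne_iff.1 hx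
    refine Finset.sum_pos' (fun c _ => hS.posSemidef.dotProduct_mulVec_nonneg _)
      ⟨M.part a, M.part_mem.2 (Finset.mem_univ a), hS.dotProduct_mulVec_pos ?_⟩
    refine Function.ne_iff.2 ⟨a, ?_⟩
    simpa using ha

/-- The strict form of Fischer's inequality. -/
theorem det_lt_det_cliqueTruncation {M : CliqueModel p} {S : Matrix (Fin p) (Fin p) ℝ}
    (hS : S.PosDef) (hM : ¬ Compatible M S) : S.det < (cliqueTruncation M S).det := by
  have hT := posDef_cliqueTruncation M hS
  refine hS.det_lt_det_of_trace_eq hT ?_ (fun h => hM h.symm)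
  -- The inverse of the truncation is block diagonal, so it sees only the blocks of S and the trace
  -- equals that of the identity.
  rw [trace_mul_of_compatible
    ((compatible_cliqueTruncation M S).inv hT.det_pos.ne'.isUnit),
    Matrix.mul_nonsing_inv _ hT.det_pos.ne'.isUnit, Matrix.trace_one]

/-- The trace bound gives the exponent tr(D A⁻¹) - p = -tr(E A⁻¹), with D the truncation and E = A -
D. Since E has zero blocks, tr(E D⁻¹) = 0; adding it turns the first-order term into tr(E A⁻¹ E
D⁻¹), of second order in E. -/
theorem det_cliqueTruncation_div_det_le {M : CliqueModel p} {A : Matrix (Fin p) (Fin p) ℝ}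
    (hA : A.PosDef) :
    (cliqueTruncation M A).det / A.det ≤ Real.exp
      ((A - cliqueTruncation M A) * A⁻¹ * (A - cliqueTruncation M A) *
        (cliqueTruncation M A)⁻¹).trace := by
  have hD := posDef_cliqueTruncation M hA
  refine (hD.det_div_det_le_exp hA).trans_eq (congrArg _ ?_)
  set D := cliqueTruncation M A with hDdef
  have hDu : IsUnit D.det := hD.det_pos.ne'.isUnit
  have hAu : IsUnit A.det := hA.det_pos.ne'.isUnit
  have h1 : ((A - D) * D⁻¹).trace = 0 := by
    rw [trace_mul_of_compatible ((compatible_cliqueTruncation M A).inv hDu), cliqueTruncation_sub,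
      hDdef, cliqueTruncation_cliqueTruncation, sub_self, Matrix.zero_mul, Matrix.trace_zero]
  have h2 : (A - D) * A⁻¹ * (A - D) * D⁻¹ = (A - D) * D⁻¹ - (A - D) * A⁻¹ := by
    rw [Matrix.mul_sub ((A - D) * A⁻¹), Matrix.sub_mul _ _ D⁻¹,
      Matrix.nonsing_inv_mul_cancel_right _ _ hAu, Matrix.mul_nonsing_inv_cancel_right _ _ hDu]
  rw [h2, Matrix.trace_sub, h1, Matrix.sub_mul A, Matrix.mul_nonsing_inv _ hAu, Matrix.trace_sub,
    Matrix.trace_one]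
  ring

end CliqueGFD

/-! ### Asymptotics of the multivariate gamma function -/

namespace CliqueGFD

variable {p : ℕ}

theorem sq_Gamma_midpoint_le {x y : ℝ} (hx : 0 < x) (hy : 0 < y) :
    Real.Gamma ((x + y) / 2) ^ 2 ≤ Real.Gamma x * Real.Gamma y := by
  have h := Real.Gamma_mul_add_mul_le_rpow_Gamma_mul_rpow_Gamma hx hy (a := 1 / 2) (b := 1 / 2)
    (by norm_num) (by norm_num) (by norm_num)
  rw [← Real.sqrt_eq_rpow, ← Real.sqrt_eq_rpow, ← Real.sqrt_mul (Real.Gamma_pos_of_pos hx).le] at h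
  rw [show (x + y) / 2 = 1 / 2 * x + 1 / 2 * y by ring]
  have h0 : 0 ≤ Real.Gamma x * Real.Gamma y :=
    (mul_pos (Real.Gamma_pos_of_pos hx) (Real.Gamma_pos_of_pos hy)).le
  calc _ ≤ √(Real.Gamma x * Real.Gamma y) ^ 2 :=
        pow_le_pow_left₀ (Real.Gamma_pos_of_pos (by positivity)).le h 2
    _ = _ := Real.sq_sqrt h0

theorem tendsto_div_sub_atTop (c : ℝ) : Tendsto (fun x : ℝ => x / (x - c)) atTop (𝓝 1) := by
  have h : Tendsto (fun x : ℝ => 1 + c / (x - c)) atTop (𝓝 (1 + 0)) :=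
    tendsto_const_nhds.add (tendsto_const_nhds.div_atTop
      (tendsto_atTop_add_const_right _ (-c) tendsto_id))
  rw [add_zero] at h
  refine h.congr' ?_
  filter_upwards [eventually_gt_atTop c] with x hx
  have : x - c ≠ 0 := (sub_pos.2 hx).ne'
  field_simp
  ring

theorem tendsto_Gamma_sub_half_div :
    Tendsto (fun x : ℝ => Real.Gamma (x - 1 / 2) * x ^ (1 / 2 : ℝ) / Real.Gamma x) atTop (𝓝 1) := by
  -- Midpoint log-convexity at x - 1/2, x + 1/2 and at x - 1, x squeezes the square between x/(x -
  -- 1/2) and x/(x - 1).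
  have hsq : Tendsto (fun x : ℝ => (Real.Gamma (x - 1 / 2) / Real.Gamma x) ^ 2 * x) atTop (𝓝 1) := by
    refine tendsto_of_tendsto_of_tendsto_of_le_of_le' (tendsto_div_sub_atTop (1 / 2))
      (tendsto_div_sub_atTop 1) ?_ ?_
    · filter_upwards [eventually_gt_atTop (1 : ℝ)] with x hx
      have h1 : 0 < x - 1 / 2 := by linarith
      have h := sq_Gamma_midpoint_le h1 (show 0 < x - 1 / 2 + 1 by linarith)
      rw [Real.Gamma_add_one h1.ne', show (x - 1 / 2 + (x - 1 / 2 + 1)) / 2 = x by ring] at h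
      have hG := Real.Gamma_pos_of_pos (show 0 < x by linarith)
      rw [div_pow, div_mul_eq_mul_div, div_le_div_iff₀ h1 (by positivity)]
      nlinarith
    · filter_upwards [eventually_gt_atTop (1 : ℝ)] with x hx
      have h1 : 0 < x - 1 := by linarith
      have h := sq_Gamma_midpoint_le h1 (show 0 < x - 1 + 1 by linarith)
      rw [show (x - 1 + (x - 1 + 1)) / 2 = x - 1 / 2 by ring] at h
      have hG := Real.Gamma_pos_of_pos (show 0 < x by linarith)
      have hG1 := Real.Gamma_pos_of_pos h1
      have e : Real.Gamma x = (x - 1) * Real.Gamma (x - 1) := by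
        rw [← Real.Gamma_add_one h1.ne']; congr 1; ring
      rw [show x - 1 + 1 = x by ring] at h
      rw [div_pow, div_mul_eq_mul_div, div_le_div_iff₀ (by positivity) h1]
      calc Real.Gamma (x - 1 / 2) ^ 2 * x * (x - 1)
          ≤ Real.Gamma (x - 1) * Real.Gamma x * x * (x - 1) := by gcongr
        _ = x * Real.Gamma x ^ 2 := by rw [e]; ring
  have h := (Real.continuous_sqrt.tendsto 1).comp hsq
  rw [Real.sqrt_one] at h
  refine h.congr' ?_
  filter_upwards [eventually_gt_atTop (1 : ℝ)] with x hx
  have hG := Real.Gamma_pos_of_pos (show 0 < x by linarith)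
  have hG1 := Real.Gamma_pos_of_pos (show 0 < x - 1 / 2 by linarith)
  simp only [Function.comp]
  rw [Real.sqrt_mul (by positivity), Real.sqrt_sq (by positivity), ← Real.sqrt_eq_rpow]
  ring

theorem tendsto_Gamma_sub_nat_half_div (j : ℕ) :
    Tendsto (fun x : ℝ => Real.Gamma (x - j / 2) * x ^ ((j : ℝ) / 2) / Real.Gamma x) atTop (𝓝 1) := by
  induction j with
  | zero =>
    refine tendsto_const_nhds.congr' ?_
    filter_upwards [eventually_gt_atTop (0 : ℝ)] with x hx
    simp [(Real.Gamma_pos_of_pos hx).ne']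
  | succ j ih =>
    have h1 : Tendsto (fun x : ℝ => x - (j : ℝ) / 2) atTop atTop :=
      tendsto_atTop_add_const_right _ (-((j : ℝ) / 2)) tendsto_id
    have h2 := tendsto_Gamma_sub_half_div.comp h1
    -- Corrects the power (x - j/2)^(1/2), produced by the half step taken at x - j/2, to x^(1/2).
    have h3 : Tendsto (fun x : ℝ => (x / (x - (j : ℝ) / 2)) ^ (1 / 2 : ℝ)) atTop (𝓝 1) := by
      have := (tendsto_div_sub_atTop ((j : ℝ) / 2)).rpow_const (p := 1 / 2) (Or.inr (by norm_num))
      rwa [Real.one_rpow] at this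
    have h := (h2.mul ih).mul h3
    rw [mul_one, mul_one] at h
    refine h.congr' ?_
    filter_upwards [eventually_gt_atTop ((j : ℝ) / 2 + 1)] with x hx
    have hj : (0 : ℝ) ≤ (j : ℝ) / 2 := by positivity
    have hx0 : 0 < x := by linarith
    have hz : 0 < x - (j : ℝ) / 2 := by linarith
    have hG := (Real.Gamma_pos_of_pos hx0).ne'
    have hGz := (Real.Gamma_pos_of_pos hz).ne'
    have hzp : (x - (j : ℝ) / 2) ^ (1 / 2 : ℝ) ≠ 0 := (Real.rpow_pos_of_pos hz _).ne'
    simp only [Function.comp]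
    rw [show x - ((j + 1 : ℕ) : ℝ) / 2 = x - (j : ℝ) / 2 - 1 / 2 by push_cast; ring,
      show ((j + 1 : ℕ) : ℝ) / 2 = (j : ℝ) / 2 + 1 / 2 by push_cast; ring,
      Real.rpow_add hx0, Real.div_rpow hx0.le hz.le]
    generalize x - (j : ℝ) / 2 = z at hGz hzp ⊢
    field_simp

theorem tendsto_multivariateGamma_div (g : ℕ) :
    Tendsto (fun x : ℝ => multivariateGamma g x * x ^ ((g : ℝ) * ((g : ℝ) - 1) / 4) /
      Real.Gamma x ^ g) atTop (𝓝 (Real.pi ^ ((g : ℝ) * ((g : ℝ) - 1) / 4))) := by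
  have h : Tendsto (fun x : ℝ => ∏ j ∈ Finset.range g,
      (Real.Gamma (x - j / 2) * x ^ ((j : ℝ) / 2) / Real.Gamma x)) atTop (𝓝 1) := by
    have := tendsto_finsetProd (Finset.range g) fun j _ => tendsto_Gamma_sub_nat_half_div j
    simpa using this
  have h' := h.const_mul (Real.pi ^ ((g : ℝ) * ((g : ℝ) - 1) / 4))
  rw [mul_one] at h'
  refine h'.congr' ?_
  filter_upwards [eventually_gt_atTop (0 : ℝ)] with x hx
  have hsum : ∑ j ∈ Finset.range g, (j : ℝ) / 2 = (g : ℝ) * ((g : ℝ) - 1) / 4 := by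
    clear h h'
    induction g with
    | zero => simp
    | succ g ih => rw [Finset.sum_range_succ, ih]; push_cast; ring
  rw [Finset.prod_div_distrib, Finset.prod_mul_distrib, ← Real.rpow_sum_of_pos hx, hsum,
    Finset.prod_const, Finset.card_range, multivariateGamma]
  have : ∏ j ∈ Finset.Icc 1 g, Real.Gamma (x + (1 - (j : ℝ)) / 2)
      = ∏ j ∈ Finset.range g, Real.Gamma (x - j / 2) := by
    refine Finset.prod_nbij' (· - 1) (· + 1) ?_ ?_ ?_ ?_ fun j hj => ?_
    · intro j hj; simp at hj ⊢; omega
    · intro j hj; simp at hj ⊢; omega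
    · intro j hj; simp at hj ⊢; omega
    · intro j hj; simp
    · rw [Nat.cast_sub (Finset.mem_Icc.1 hj).1]; congr 1; push_cast; ring
  rw [this]
  ring

/-- The exponent of `n` gained by the gamma factors of the clique model `M`. -/
noncomputable def gammaExponent (M : CliqueModel p) : ℝ :=
  ∑ c ∈ M.parts, (c.card : ℝ) * ((c.card : ℝ) - 1) / 4

/-- Clique sizes sum to p, so the normalizer Γ(x)^p is the same for every model and cancels in
ratios. -/
theorem tendsto_prod_multivariateGamma_div (M : CliqueModel p) :
    Tendsto (fun x : ℝ => (∏ c ∈ M.parts, multivariateGamma c.card x) * x ^ gammaExponent M /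
      Real.Gamma x ^ p) atTop (𝓝 (Real.pi ^ gammaExponent M)) := by
  have h := tendsto_finsetProd M.parts fun c _ => tendsto_multivariateGamma_div c.card
  rw [← Real.rpow_sum_of_pos Real.pi_pos] at h
  refine h.congr' ?_
  filter_upwards [eventually_gt_atTop (0 : ℝ)] with x hx
  rw [Finset.prod_div_distrib, Finset.prod_mul_distrib, ← Real.rpow_sum_of_pos hx,
    Finset.prod_pow_eq_pow_sum, M.sum_card_parts, Finset.card_univ, Fintype.card_fin]
  rfl

theorem tendsto_prod_multivariateGamma_ratio (M M₀ : CliqueModel p) :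
    Tendsto (fun x : ℝ => (∏ c ∈ M.parts, multivariateGamma c.card x) /
      (∏ c ∈ M₀.parts, multivariateGamma c.card x) * x ^ (gammaExponent M - gammaExponent M₀))
      atTop (𝓝 (Real.pi ^ (gammaExponent M - gammaExponent M₀))) := by
  have h := (tendsto_prod_multivariateGamma_div M).div (tendsto_prod_multivariateGamma_div M₀)
    (Real.rpow_pos_of_pos Real.pi_pos _).ne'
  rw [← Real.rpow_sub Real.pi_pos] at h
  refine h.congr' ?_
  filter_upwards [eventually_gt_atTop (0 : ℝ)] with x hx
  have hG := (pow_pos (Real.Gamma_pos_of_pos hx) p).ne'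
  have h1 := (Real.rpow_pos_of_pos hx (gammaExponent M₀)).ne'
  simp only [Pi.div_apply]
  rw [Real.rpow_sub hx, div_div_div_cancel_right₀ hG]
  ring

theorem multivariateGamma_pos {g : ℕ} {x : ℝ} (hx : (g : ℝ) / 2 ≤ x) :
    0 < multivariateGamma g x := by
  refine mul_pos (Real.rpow_pos_of_pos Real.pi_pos _) (Finset.prod_pos fun j hj => ?_)
  have hj' : (j : ℝ) ≤ g := by exact_mod_cast (Finset.mem_Icc.1 hj).2
  exact Real.Gamma_pos_of_pos (by linarith)

theorem sum_card_sq_parts (M : CliqueModel p) :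
    ∑ c ∈ M.parts, (c.card : ℝ) ^ 2 = ∑ a, ((M.part a).card : ℝ) := by
  have h : ∑ a, ((M.part a).card : ℝ) = ∑ a ∈ M.parts.biUnion id, ((M.part a).card : ℝ) :=
    Finset.sum_congr M.biUnion_parts.symm fun _ _ => rfl
  rw [h, Finset.sum_biUnion M.supIndep.pairwiseDisjoint]
  refine Finset.sum_congr rfl fun c hc => ?_
  rw [Finset.sum_congr rfl fun a ha => by rw [M.part_eq_of_mem hc ha]]
  simp [sq]

/-- The exponent is an increasing affine function of ∑ g², which is the sum over coordinates of the
size of the clique containing them. Merging never shrinks these sizes and enlarges at least one. -/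
theorem gammaExponent_lt {M₀ M : CliqueModel p} (h : M₀ < M) :
    gammaExponent M₀ < gammaExponent M := by
  have e : ∀ M : CliqueModel p,
      gammaExponent M = (∑ a, ((M.part a).card : ℝ) - p) / 4 := fun M => by
    have hp : ∑ c ∈ M.parts, (c.card : ℝ) = p := by
      rw [← Nat.cast_sum, M.sum_card_parts, Finset.card_univ, Fintype.card_fin]
    rw [← sum_card_sq_parts, ← hp, ← Finset.sum_sub_distrib, Finset.sum_div]
    exact Finset.sum_congr rfl fun c _ => by ring
  rw [e, e]
  have : ∑ a, ((M₀.part a).card : ℝ) < ∑ a, ((M.part a).card : ℝ) := by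
    refine Finset.sum_lt_sum (fun a _ => by
      exact_mod_cast Finset.card_le_card (part_subset_part h.le a)) ?_
    by_contra! hc
    refine h.not_ge fun c hc' => ?_
    obtain ⟨a, ha⟩ := M.nonempty_of_mem_parts hc'
    refine ⟨M₀.part a, M₀.part_mem.2 (Finset.mem_univ a), ?_⟩
    have := Finset.eq_of_subset_of_card_le (part_subset_part h.le a)
      (by exact_mod_cast hc a (Finset.mem_univ a))
    rw [this, M.part_eq_of_mem hc' ha]
  linarith

end CliqueGFD

/-! ### Bounds for the Jacobian constants -/

namespace CliqueGFD

variable {n p g : ℕ}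

/-- In the Leibniz expansion, summing over all row choices f factorizes by distributivity, with the
same value for each of the g! permutations. -/
theorem sum_abs_det_submatrix_le (y : Matrix (Fin n) (Fin p) ℝ) (e : Fin g → Fin p) :
    ∑ f : Fin g → Fin n, |(y.submatrix f e).det| ≤ g.factorial * ∏ i, ∑ k, |y k (e i)| := by
  have h1 : ∀ f : Fin g → Fin n, |(y.submatrix f e).det| ≤
      ∑ σ : Equiv.Perm (Fin g), ∏ i, |y (f (σ i)) (e i)| := fun f => by
    rw [Matrix.det_apply]
    refine (Finset.abs_sum_le_sum_abs _ _).trans (Finset.sum_le_sum fun σ _ => le_of_eq ?_)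
    rw [Units.smul_def, zsmul_eq_mul, abs_mul, Finset.abs_prod]
    rcases Int.units_eq_one_or (Equiv.Perm.sign σ) with h | h <;> simp [h]
  refine (Finset.sum_le_sum fun f _ => h1 f).trans (le_of_eq ?_)
  rw [Finset.sum_comm]
  have h2 : ∀ σ : Equiv.Perm (Fin g), ∑ f : Fin g → Fin n, ∏ i, |y (f (σ i)) (e i)|
      = ∏ i, ∑ k, |y k (e i)| := fun σ => by
    rw [Finset.prod_univ_sum, Fintype.piFinset_univ]
    exact Fintype.sum_equiv (σ.symm.arrowCongr (Equiv.refl _)) _ _ fun f => rfl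
  rw [Finset.sum_congr rfl fun σ _ => h2 σ]
  simp [Fintype.card_perm]

theorem sum_abs_le_sampleCov (y : Matrix (Fin n) (Fin p) ℝ) (a : Fin p) :
    ∑ k, |y k a| ≤ n * (1 + sampleCov y a a) := by
  rcases Nat.eq_zero_or_pos n with rfl | hn
  · simp
  have hn' : (n : ℝ) ≠ 0 := by positivity
  have : (n : ℝ) * (1 + sampleCov y a a) = ∑ k, (1 + y k a * y k a) := by
    rw [sampleCov, Matrix.of_apply, Finset.sum_add_distrib]
    simp
    field_simp
  rw [this]
  refine Finset.sum_le_sum fun k _ => ?_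
  rw [← abs_mul_abs_self]
  nlinarith [sq_nonneg (|y k a| - 1), abs_nonneg (y k a)]

theorem sampleCov_diag_nonneg (y : Matrix (Fin n) (Fin p) ℝ) (a : Fin p) :
    0 ≤ sampleCov y a a :=
  div_nonneg (Finset.sum_nonneg fun _ _ => mul_self_nonneg _) (Nat.cast_nonneg _)

open Classical in
/-- The average of `|det|` over all choices of `#c` rows of the columns of `y` indexed by `c`. -/
noncomputable def averageAbsDet (y : Matrix (Fin n) (Fin p) ℝ) (c : Finset (Fin p)) : ℝ :=
  (n.choose c.card : ℝ)⁻¹ *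
    ∑ f : Fin c.card → Fin n,
      if StrictMono f then |(y.submatrix f (c.orderEmbOfFin rfl)).det| else 0

theorem averageAbsDet_nonneg (y : Matrix (Fin n) (Fin p) ℝ) (c : Finset (Fin p)) :
    0 ≤ averageAbsDet y c :=
  mul_nonneg (by positivity) (Finset.sum_nonneg fun f _ => by split_ifs <;> positivity)

theorem averageAbsDet_le (y : Matrix (Fin n) (Fin p) ℝ) (c : Finset (Fin p))
    (hn : 2 * c.card ≤ n) :
    averageAbsDet y c ≤ (c.card.factorial : ℝ) ^ 2 * 2 ^ c.card *
      ∏ i, (1 + sampleCov y (c.orderEmbOfFin rfl i) (c.orderEmbOfFin rfl i)) := by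
  set g := c.card with hg
  set e : Fin g → Fin p := ⇑(c.orderEmbOfFin (rfl : c.card = c.card)) with he
  set Q := ∏ i, (1 + sampleCov y (e i) (e i))
  have hQ : 0 ≤ Q := Finset.prod_nonneg fun i _ => by
    have := sampleCov_diag_nonneg y (e i); positivity
  have hch : 0 < (n.choose g : ℝ) := by exact_mod_cast Nat.choose_pos (by omega)
  have h1 : (∑ f : Fin g → Fin n, open Classical in
      if StrictMono f then |(y.submatrix f e).det| else 0) ≤ g.factorial * (n ^ g * Q) := by
    calc _ ≤ ∑ f : Fin g → Fin n, |(y.submatrix f e).det| :=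
          Finset.sum_le_sum fun f _ => by split_ifs <;> simp
      _ ≤ g.factorial * ∏ i, ∑ k, |y k (e i)| := sum_abs_det_submatrix_le y e
      _ ≤ g.factorial * ∏ i : Fin g, (n * (1 + sampleCov y (e i) (e i))) := by
          gcongr with i
          exact sum_abs_le_sampleCov y (e i)
      _ = _ := by rw [Finset.prod_mul_distrib]; simp [Q]
  -- From n ≥ 2g follows n ≤ 2(n + 1 - g), and (n + 1 - g)^g ≤ g! · binom(n, g).
  have h2 : (n : ℝ) ^ g ≤ 2 ^ g * (g.factorial * n.choose g) := by
    have h := Nat.pow_le_choose g n (α := ℝ)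
    rw [div_le_iff₀' (by positivity)] at h
    refine le_trans ?_ (mul_le_mul_of_nonneg_left h (by positivity))
    rw [← mul_pow]
    gcongr
    have : n ≤ 2 * (n + 1 - g) := by omega
    exact_mod_cast this
  calc averageAbsDet y c ≤ (n.choose g : ℝ)⁻¹ * (g.factorial * (n ^ g * Q)) := by
        unfold averageAbsDet
        gcongr
    _ ≤ (n.choose g : ℝ)⁻¹ * (g.factorial * (2 ^ g * (g.factorial * n.choose g) * Q)) := by gcongr
    _ = _ := by field_simp; ring

/-- A form of Cauchy–Binet: each row of the Gram matrix is a combination of rows of z, and the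
determinant is multilinear in the rows. -/
theorem det_sum_mul_mul_eq (z : Matrix (Fin n) (Fin p) ℝ) (e : Fin g → Fin p) :
    (Matrix.of fun i j => ∑ k, z k (e i) * z k (e j)).det
      = ∑ f : Fin g → Fin n, (∏ i, z (f i) (e i)) * (z.submatrix f e).det := by
  have h := (Matrix.detRowAlternating (n := Fin g) (R := ℝ)).toMultilinearMap.map_sum
    (fun i (k : Fin n) => z k (e i) • fun j => z k (e j))
  have h0 : (Matrix.of fun i j => ∑ k, z k (e i) * z k (e j))
      = fun i => ∑ k, (z k (e i) • fun j => z k (e j)) := by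
    ext i j
    simp [Finset.sum_apply]
  rw [h0]
  refine h.trans (Finset.sum_congr rfl fun f _ => ?_)
  rw [MultilinearMap.map_smul_univ]
  rfl

open Classical in
theorem sum_le_factorial_mul_sum_strictMono (F : (Fin g → Fin n) → ℝ) (hF : ∀ f, 0 ≤ F f)
    (hperm : ∀ f (σ : Equiv.Perm (Fin g)), F (f ∘ σ) = F f)
    (hinj : ∀ f, ¬ Function.Injective f → F f = 0) :
    ∑ f, F f ≤ g.factorial * ∑ f, if StrictMono f then F f else 0 := by
  have h1 : ∀ f, F f ≤ ∑ σ : Equiv.Perm (Fin g), if StrictMono (f ∘ σ) then F (f ∘ σ) else 0 := by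
    intro f
    have h0 : ∀ σ : Equiv.Perm (Fin g), σ ∈ Finset.univ →
        0 ≤ if StrictMono (f ∘ σ) then F (f ∘ σ) else 0 := fun σ _ => by
      split_ifs
      exacts [hF _, le_rfl]
    by_cases hf : Function.Injective f
    · refine le_trans ?_ (Finset.single_le_sum h0 (Finset.mem_univ (Tuple.sort f)))
      rw [if_pos ((Tuple.monotone_sort f).strictMono_of_injective
        (hf.comp (Tuple.sort f).injective)), hperm]
    · rw [hinj f hf]
      exact Finset.sum_nonneg h0
  refine (Finset.sum_le_sum fun f _ => h1 f).trans (le_of_eq ?_)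
  rw [Finset.sum_comm]
  have h2 : ∀ σ : Equiv.Perm (Fin g),
      (∑ f : Fin g → Fin n, if StrictMono (f ∘ σ) then F (f ∘ σ) else 0)
        = ∑ f, if StrictMono f then F f else 0 := fun σ =>
    Fintype.sum_equiv (σ.symm.arrowCongr (Equiv.refl _)) _ _ fun f => rfl
  rw [Finset.sum_congr rfl fun σ _ => h2 σ]
  simp [Fintype.card_perm]

/-- Expand the Gram determinant of the weighted data over row choices. Weighted entries of size at
most 1 remove the products, sorting the rows costs g!, absorbed by g! · binom(n, g) ≤ n^g, and
weights at most 1 only decrease |det|. -/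
theorem det_cliqueBlock_le_averageAbsDet (y : Matrix (Fin n) (Fin p) ℝ) (c : Finset (Fin p))
    (hn : c.card ≤ n) (hn0 : 0 < n) (w : Fin n → ℝ) (hw0 : ∀ k, 0 ≤ w k) (hw1 : ∀ k, w k ≤ 1)
    (hwy : ∀ k a, |w k * y k a| ≤ 1) :
    (cliqueBlock c (sampleCov (Matrix.of fun k a => w k * y k a))).det ≤ averageAbsDet y c := by
  set g := c.card with hg
  set e : Fin g → Fin p := ⇑(c.orderEmbOfFin (rfl : c.card = c.card)) with he
  set z : Matrix (Fin n) (Fin p) ℝ := Matrix.of fun k a => w k * y k a with hz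
  have hnR : (0 : ℝ) < n := by exact_mod_cast hn0
  have hch : 0 < (n.choose g : ℝ) := by exact_mod_cast Nat.choose_pos hn
  have h1 : (cliqueBlock c (sampleCov z)).det
      = ((n : ℝ) ^ g)⁻¹ * ∑ f : Fin g → Fin n, (∏ i, z (f i) (e i)) * (z.submatrix f e).det := by
    rw [← det_sum_mul_mul_eq, ← Matrix.det_submatrix_equiv_self (c.orderIsoOfFin rfl).toEquiv]
    have : (cliqueBlock c (sampleCov z)).submatrix (c.orderIsoOfFin rfl).toEquiv
        (c.orderIsoOfFin rfl).toEquiv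
        = (n : ℝ)⁻¹ • (Matrix.of fun i j => ∑ k, z k (e i) * z k (e j)) := by
      ext i j
      simp [cliqueBlock, sampleCov, e, div_eq_inv_mul]
    rw [this, Matrix.det_smul, Fintype.card_fin, inv_pow]
  have h2 : ∑ f : Fin g → Fin n, (∏ i, z (f i) (e i)) * (z.submatrix f e).det
      ≤ ∑ f : Fin g → Fin n, |(z.submatrix f e).det| := by
    refine Finset.sum_le_sum fun f _ => (le_abs_self _).trans ?_
    rw [abs_mul, Finset.abs_prod]
    exact mul_le_of_le_one_left (abs_nonneg _)
      (Finset.prod_le_one (fun _ _ => abs_nonneg _) fun i _ => hwy _ _)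
  have h3 : ∑ f : Fin g → Fin n, |(z.submatrix f e).det| ≤ g.factorial *
      ∑ f : Fin g → Fin n, open Classical in
        if StrictMono f then |(z.submatrix f e).det| else 0 := by
    refine sum_le_factorial_mul_sum_strictMono _ (fun _ => abs_nonneg _) (fun f σ => ?_)
      fun f hf => ?_
    · have : z.submatrix (f ∘ σ) e = (z.submatrix f e).submatrix σ id := rfl
      rw [this, Matrix.det_permute, abs_mul]
      rcases Int.units_eq_one_or (Equiv.Perm.sign σ) with h | h <;> simp [h]
    · simp only [Function.Injective, not_forall] at hf
      obtain ⟨i, j, hij, hne⟩ := hf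
      rw [Matrix.det_zero_of_row_eq hne (by ext k; simp [hij]), abs_zero]
  have h4 : ∀ f : Fin g → Fin n, |(z.submatrix f e).det| ≤ |(y.submatrix f e).det| := fun f => by
    have : z.submatrix f e = Matrix.of fun i j => w (f i) * (y.submatrix f e) i j := rfl
    rw [this, Matrix.det_mul_column, abs_mul, Finset.abs_prod]
    exact mul_le_of_le_one_left (abs_nonneg _)
      (Finset.prod_le_one (fun _ _ => abs_nonneg _) fun i _ => by
        rw [abs_of_nonneg (hw0 _)]; exact hw1 _)
  have h5 : (∑ f : Fin g → Fin n, open Classical in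
      if StrictMono f then |(z.submatrix f e).det| else 0) ≤ n.choose g * averageAbsDet y c := by
    rw [averageAbsDet, mul_inv_cancel_left₀ hch.ne']
    refine Finset.sum_le_sum fun f _ => ?_
    split_ifs
    exacts [h4 f, le_rfl]
  have h6 : (g.factorial : ℝ) * n.choose g ≤ (n : ℝ) ^ g := by
    have := Nat.choose_le_pow_div g n (α := ℝ)
    rw [le_div_iff₀ (by positivity)] at this
    linarith
  rw [h1, inv_mul_le_iff₀ (by positivity)]
  calc _ ≤ (g.factorial : ℝ) * (n.choose g * averageAbsDet y c) :=
        h2.trans (h3.trans (by gcongr))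
    _ ≤ _ := by
      rw [← mul_assoc]
      exact mul_le_mul_of_nonneg_right h6 (averageAbsDet_nonneg y c)

theorem jacobianConst_nonneg (N : JacobianNorm) (y : Matrix (Fin n) (Fin p) ℝ)
    (c : Finset (Fin p)) : 0 ≤ jacobianConst N y c := by
  cases N with
  | l2 => exact Real.rpow_nonneg (abs_nonneg _) _
  | linf => exact pow_nonneg (averageAbsDet_nonneg y c) _

end CliqueGFD

/-! ### Consistency along a filter of data sets -/

namespace CliqueGFD

variable {p : ℕ}

theorem posSemidef_sampleCov {n : ℕ} (y : Matrix (Fin n) (Fin p) ℝ) :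
    (sampleCov y).PosSemidef := by
  have h : sampleCov y = (n : ℝ)⁻¹ • (y.conjTranspose * y) := by
    ext a b
    simp [sampleCov, Matrix.mul_apply, div_eq_inv_mul]
  rw [h]
  exact (Matrix.posSemidef_conjTranspose_mul_self y).smul (by positivity)

theorem continuous_cliqueTruncation (M : CliqueModel p) : Continuous (cliqueTruncation M) := by
  refine continuous_matrix fun a b => ?_
  simp only [cliqueTruncation_apply]
  split_ifs
  · exact continuous_id.matrix_elem a b
  · exact continuous_const

theorem continuous_cliqueBlock (c : Finset (Fin p)) : Continuous (cliqueBlock c) :=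
  continuous_id.matrix_submatrix _ _

theorem tendsto_matrix_inv {ι κ : Type*} [Fintype κ] [DecidableEq κ] {l : Filter ι}
    {A : ι → Matrix κ κ ℝ} {A₀ : Matrix κ κ ℝ} (hA : Tendsto A l (𝓝 A₀)) (h0 : A₀.det ≠ 0) :
    Tendsto (fun i => (A i)⁻¹) l (𝓝 A₀⁻¹) := by
  simp only [Matrix.inv_def, Ring.inverse_eq_inv']
  exact (((continuous_id.matrix_det.tendsto A₀).comp hA).inv₀ h0).smul
    ((continuous_id.matrix_adjugate.tendsto A₀).comp hA)

/-- The factor of the ratio of two generalized fiducial probabilities free of the data. -/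
noncomputable def constantRatio (M M₀ : CliqueModel p) : ℝ :=
  (Real.pi ^ ((∑ c ∈ M.parts, (c.card : ℝ) ^ 2) / 2) /
    ∏ c ∈ M.parts, multivariateGamma c.card ((c.card : ℝ) / 2)) /
  (Real.pi ^ ((∑ c ∈ M₀.parts, (c.card : ℝ) ^ 2) / 2) /
    ∏ c ∈ M₀.parts, multivariateGamma c.card ((c.card : ℝ) / 2))

theorem constantRatio_pos (M M₀ : CliqueModel p) : 0 < constantRatio M M₀ := by
  have h : ∀ M : CliqueModel p, 0 < Real.pi ^ ((∑ c ∈ M.parts, (c.card : ℝ) ^ 2) / 2) /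
      ∏ c ∈ M.parts, multivariateGamma c.card ((c.card : ℝ) / 2) := fun M =>
    div_pos (Real.rpow_pos_of_pos Real.pi_pos _)
      (Finset.prod_pos fun c _ => multivariateGamma_pos le_rfl)
  exact div_pos (h M) (h M₀)

theorem gfdWeight_div_gfdWeight (N : JacobianNorm) {n : ℕ} (M M₀ : CliqueModel p)
    (y : Matrix (Fin n) (Fin p) ℝ) :
    gfdWeight N M y / gfdWeight N M₀ y = constantRatio M M₀ *
      (|(cliqueTruncation M₀ (sampleCov y)).det| / |(cliqueTruncation M (sampleCov y)).det|) ^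
        ((n : ℝ) / 2) *
      ((∏ c ∈ M.parts, jacobianConst N y c) / ∏ c ∈ M₀.parts, jacobianConst N y c) *
      ((∏ c ∈ M.parts, multivariateGamma c.card ((n : ℝ) / 2)) /
        ∏ c ∈ M₀.parts, multivariateGamma c.card ((n : ℝ) / 2)) := by
  rw [Real.div_rpow (abs_nonneg _) (abs_nonneg _)]
  simp only [gfdWeight, constantRatio, Finset.prod_mul_distrib, Finset.prod_div_distrib]
  simp only [div_eq_mul_inv, mul_inv, inv_inv]
  ring

section Asymptotics

variable {ι : Type*} {l : Filter ι} {n : ι → ℕ} {y : ∀ i, Matrix (Fin (n i)) (Fin p) ℝ}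
  {S₀ : Matrix (Fin p) (Fin p) ℝ}

theorem eventually_posDef_sampleCov (hS₀ : S₀.PosDef)
    (hS : Tendsto (fun i => sampleCov (y i)) l (𝓝 S₀)) : ∀ᶠ i in l, (sampleCov (y i)).PosDef := by
  have h := (continuous_id.matrix_det.tendsto S₀).comp hS
  filter_upwards [h.eventually_ne hS₀.det_pos.ne'] with i hi
  -- Being always semidefinite, the sample covariance is definite as soon as its determinant is
  -- nonzero, an open condition.
  exact (posSemidef_sampleCov (y i)).posDef_iff_det_ne_zero.2 hi

theorem tendsto_det_cliqueTruncation (M : CliqueModel p)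
    (hS : Tendsto (fun i => sampleCov (y i)) l (𝓝 S₀)) :
    Tendsto (fun i => (cliqueTruncation M (sampleCov (y i))).det) l
      (𝓝 (cliqueTruncation M S₀).det) :=
  ((continuous_cliqueTruncation M).matrix_det.tendsto S₀).comp hS

theorem tendsto_abs_det_cliqueBlock (c : Finset (Fin p))
    (hS : Tendsto (fun i => sampleCov (y i)) l (𝓝 S₀)) :
    Tendsto (fun i => |(cliqueBlock c (sampleCov (y i))).det|) l (𝓝 |(cliqueBlock c S₀).det|) :=
  ((continuous_cliqueBlock c).matrix_det.abs.tendsto S₀).comp hS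

theorem tendsto_jacobianConst_l2 (c : Finset (Fin p))
    (hS : Tendsto (fun i => sampleCov (y i)) l (𝓝 S₀)) :
    Tendsto (fun i => jacobianConst .l2 (y i) c) l
      (𝓝 (|(cliqueBlock c S₀).det| ^ ((c.card : ℝ) / 2))) :=
  (tendsto_abs_det_cliqueBlock c hS).rpow_const (Or.inr (by positivity))

theorem eventually_jacobianConst_le (N : JacobianNorm) (hn : Tendsto n l atTop)
    (hS : Tendsto (fun i => sampleCov (y i)) l (𝓝 S₀)) (c : Finset (Fin p)) :
    ∃ B, ∀ᶠ i in l, jacobianConst N (y i) c ≤ B := by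
  cases N with
  | l2 => exact ⟨_, (tendsto_jacobianConst_l2 c hS).eventually_le_const (lt_add_one _)⟩
  | linf =>
    have h : Tendsto (fun i => ((c.card.factorial : ℝ) ^ 2 * 2 ^ c.card * ∏ k,
        (1 + sampleCov (y i) (c.orderEmbOfFin rfl k) (c.orderEmbOfFin rfl k))) ^ c.card) l
        (𝓝 (((c.card.factorial : ℝ) ^ 2 * 2 ^ c.card * ∏ k,
        (1 + S₀ (c.orderEmbOfFin rfl k) (c.orderEmbOfFin rfl k))) ^ c.card)) := by
      refine Tendsto.pow (Tendsto.const_mul _ (tendsto_finsetProd _ fun k _ => ?_)) _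
      exact tendsto_const_nhds.add (((continuous_id.matrix_elem _ _).tendsto S₀).comp hS)
    obtain ⟨B, hB⟩ := h.isBoundedUnder_le
    refine ⟨B, ?_⟩
    filter_upwards [eventually_map.1 hB, hn.eventually_ge_atTop (2 * c.card)] with i h1 h2
    exact (pow_le_pow_left₀ (averageAbsDet_nonneg _ _) (averageAbsDet_le (y i) c h2) _).trans h1

theorem eventually_prod_jacobianConst_le (N : JacobianNorm) (hn : Tendsto n l atTop)
    (hS : Tendsto (fun i => sampleCov (y i)) l (𝓝 S₀)) (s : Finset (Finset (Fin p))) :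
    ∃ B, ∀ᶠ i in l, ∏ c ∈ s, jacobianConst N (y i) c ≤ B := by
  choose B hB using eventually_jacobianConst_le N hn hS
  refine ⟨∏ c ∈ s, B c, ?_⟩
  filter_upwards [(Filter.eventually_all_finset s).2 fun c _ => hB c] with i hi
  exact Finset.prod_le_prod (fun c _ => jacobianConst_nonneg _ _ _) hi

theorem eventually_le_prod_jacobianConst {N : JacobianNorm}
    (hJ : ∀ c, ∃ δ > 0, ∀ᶠ i in l, δ ≤ jacobianConst N (y i) c) (s : Finset (Finset (Fin p))) :
    ∃ δ > 0, ∀ᶠ i in l, δ ≤ ∏ c ∈ s, jacobianConst N (y i) c := by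
  choose δ hδ hJ using hJ
  refine ⟨∏ c ∈ s, δ c, Finset.prod_pos fun c _ => hδ c, ?_⟩
  filter_upwards [(Filter.eventually_all_finset s).2 fun c _ => hJ c] with i hi
  exact Finset.prod_le_prod (fun c _ => (hδ c).le) hi

theorem tendsto_natCast_div_two (hn : Tendsto n l atTop) :
    Tendsto (fun i => (n i : ℝ) / 2) l atTop :=
  (tendsto_natCast_atTop_atTop.comp hn).atTop_div_const (by norm_num)

/-- Up to a constant, a ratio of generalized fiducial probabilities is at most the ratio of the
maximized likelihoods times a power of the sample size. -/
theorem eventually_gfdWeight_div_le (N : JacobianNorm) (hn : Tendsto n l atTop)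
    (hS : Tendsto (fun i => sampleCov (y i)) l (𝓝 S₀))
    (hJ : ∀ c, ∃ δ > 0, ∀ᶠ i in l, δ ≤ jacobianConst N (y i) c) (M M₀ : CliqueModel p) :
    ∃ K > 0, ∀ᶠ i in l, 0 ≤ gfdWeight N M (y i) / gfdWeight N M₀ (y i) ∧
      gfdWeight N M (y i) / gfdWeight N M₀ (y i) ≤
      K * (|(cliqueTruncation M₀ (sampleCov (y i))).det| /
        |(cliqueTruncation M (sampleCov (y i))).det|) ^ ((n i : ℝ) / 2) *
        ((n i : ℝ) / 2) ^ (gammaExponent M₀ - gammaExponent M) := by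
  obtain ⟨B, hB⟩ := eventually_prod_jacobianConst_le N hn hS M.parts
  obtain ⟨δ, hδ, hJ⟩ := eventually_le_prod_jacobianConst hJ M₀.parts
  have hG := ((tendsto_prod_multivariateGamma_ratio M M₀).comp
    (tendsto_natCast_div_two hn)).eventually_le_const (lt_add_one _)
  set G := Real.pi ^ (gammaExponent M - gammaExponent M₀) + 1 with hGdef
  have hG0 : 0 < G := by positivity
  have hκ := constantRatio_pos M M₀
  refine ⟨constantRatio M M₀ * ((|B| + 1) / δ) * G, by positivity, ?_⟩
  -- The bound p + 1 keeps n positive even when p = 0.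
  filter_upwards [hB, hJ, hG, hn.eventually_ge_atTop (p + 1)] with i hB hJ hG hni
  have hx : (0 : ℝ) < (n i : ℝ) / 2 := by
    have : (0 : ℝ) < n i := by exact_mod_cast (by omega)
    positivity
  have hΓ : ∀ M : CliqueModel p,
      0 < ∏ c ∈ M.parts, multivariateGamma c.card ((n i : ℝ) / 2) := fun M =>
    Finset.prod_pos fun c _ => multivariateGamma_pos (by
      have : c.card ≤ n i := (Finset.card_le_univ c).trans (by simp; omega)
      have : (c.card : ℝ) ≤ n i := by exact_mod_cast this
      linarith)
  have hJ0 : 0 ≤ ∏ c ∈ M.parts, jacobianConst N (y i) c :=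
    Finset.prod_nonneg fun c _ => jacobianConst_nonneg _ _ _
  have hJδ : 0 < ∏ c ∈ M₀.parts, jacobianConst N (y i) c := hδ.trans_le hJ
  have hΓM := hΓ M
  have hΓM₀ := hΓ M₀
  rw [gfdWeight_div_gfdWeight]
  refine ⟨by positivity, ?_⟩
  have h1 : (∏ c ∈ M.parts, jacobianConst N (y i) c) / ∏ c ∈ M₀.parts, jacobianConst N (y i) c
      ≤ (|B| + 1) / δ :=
    div_le_div₀ (by positivity) (hB.trans ((le_abs_self B).trans (by linarith))) hδ hJ
  have h2 : (∏ c ∈ M.parts, multivariateGamma c.card ((n i : ℝ) / 2)) /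
      (∏ c ∈ M₀.parts, multivariateGamma c.card ((n i : ℝ) / 2)) ≤
      G * ((n i : ℝ) / 2) ^ (gammaExponent M₀ - gammaExponent M) := by
    simp only [Function.comp] at hG
    rw [← neg_sub, Real.rpow_neg hx.le, ← div_eq_mul_inv,
      le_div_iff₀ (Real.rpow_pos_of_pos hx _)]
    exact hG
  calc _ ≤ constantRatio M M₀ * (|(cliqueTruncation M₀ (sampleCov (y i))).det| /
        |(cliqueTruncation M (sampleCov (y i))).det|) ^ ((n i : ℝ) / 2) * ((|B| + 1) / δ) *
        (G * ((n i : ℝ) / 2) ^ (gammaExponent M₀ - gammaExponent M)) := by gcongr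
    _ = _ := by ring

theorem tendsto_gfdWeight_div_of_not_compatible (N : JacobianNorm) (hn : Tendsto n l atTop)
    (hS₀ : S₀.PosDef) (hS : Tendsto (fun i => sampleCov (y i)) l (𝓝 S₀))
    (hJ : ∀ c, ∃ δ > 0, ∀ᶠ i in l, δ ≤ jacobianConst N (y i) c) {M M₀ : CliqueModel p}
    (hM₀ : Compatible M₀ S₀) (hM : ¬ Compatible M S₀) {r : ℕ → ℝ} (hr : ∀ n, 0 ≤ r n)
    (hr0 : ∀ a : ℝ, 0 < a → Tendsto (fun n : ℕ => Real.exp (-a * n) * r n) atTop (𝓝 0)) :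
    Tendsto (fun i => gfdWeight N M (y i) / gfdWeight N M₀ (y i) * r (n i)) l (𝓝 0) := by
  obtain ⟨K, hK, hle⟩ := eventually_gfdWeight_div_le N hn hS hJ M M₀
  set β := gammaExponent M₀ - gammaExponent M
  have hdet := det_lt_det_cliqueTruncation hS₀ hM
  have hdM := (posDef_cliqueTruncation M hS₀).det_pos
  have hρ : |(cliqueTruncation M₀ S₀).det| / |(cliqueTruncation M S₀).det| < 1 := by
    rw [show cliqueTruncation M₀ S₀ = S₀ from hM₀, abs_of_pos hS₀.det_pos, abs_of_pos hdM]
    exact (div_lt_one hdM).2 hdet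
  obtain ⟨ρ, hρ1, hρ2⟩ := exists_between hρ
  have hρ0 : 0 < ρ := lt_of_le_of_lt (by positivity) hρ1
  have htend := ((tendsto_det_cliqueTruncation M₀ hS).abs.div
    (tendsto_det_cliqueTruncation M hS).abs (abs_pos.2 hdM.ne').ne').eventually_le_const hρ1
  set t := -Real.log ρ with ht
  have ht0 : 0 < t := neg_pos.2 (Real.log_neg hρ0 hρ2)
  have h1 : Tendsto (fun x : ℝ => x ^ β * Real.exp (-(t / 2) * x)) atTop (𝓝 0) :=
    tendsto_rpow_mul_exp_neg_mul_atTop_nhds_zero β (t / 2) (by positivity)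
  have h2 := ((h1.comp (tendsto_natCast_div_two hn)).mul
    ((hr0 (t / 4) (by positivity)).comp hn)).const_mul K
  rw [mul_zero, mul_zero] at h2
  refine squeeze_zero' ?_ ?_ h2
  · filter_upwards [hle] with i hi using mul_nonneg hi.1 (hr _)
  · filter_upwards [hle, htend] with i hi hdi
    refine (mul_le_mul_of_nonneg_right hi.2 (hr _)).trans ?_
    -- ρ^(n/2) = exp(-tn/2) is split into two equal halves: one absorbs the power of n, the other
    -- the penalty ratio.
    have h3 : (|(cliqueTruncation M₀ (sampleCov (y i))).det| /
        |(cliqueTruncation M (sampleCov (y i))).det|) ^ ((n i : ℝ) / 2) ≤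
        Real.exp (-(t / 2) * (n i / 2)) * Real.exp (-(t / 4) * n i) := by
      refine (Real.rpow_le_rpow (div_nonneg (abs_nonneg _) (abs_nonneg _)) hdi
        (by positivity)).trans (le_of_eq ?_)
      rw [← Real.exp_add, Real.rpow_def_of_pos hρ0, ht]
      congr 1
      ring
    have hrn := hr (n i)
    simp only [Function.comp]
    calc _ ≤ K * (Real.exp (-(t / 2) * (n i / 2)) * Real.exp (-(t / 4) * n i)) *
          ((n i : ℝ) / 2) ^ β * r (n i) := by gcongr
      _ = _ := by ring

theorem tendsto_trace_remainder (hS₀ : S₀.PosDef)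
    (hS : Tendsto (fun i => sampleCov (y i)) l (𝓝 S₀)) {s : ι → ℝ}
    (hE : ∀ a b, S₀ a b = 0 → Tendsto (fun i => s i * sampleCov (y i) a b) l (𝓝 0))
    {M M₀ : CliqueModel p} (hM₀ : Compatible M₀ S₀) (hle : M₀ ≤ M) :
    Tendsto (fun i => s i ^ 2 *
      ((cliqueTruncation M (sampleCov (y i)) - cliqueTruncation M₀ (sampleCov (y i))) *
        (cliqueTruncation M (sampleCov (y i)))⁻¹ *
        (cliqueTruncation M (sampleCov (y i)) - cliqueTruncation M₀ (sampleCov (y i))) *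
        (cliqueTruncation M₀ (sampleCov (y i)))⁻¹).trace) l (𝓝 0) := by
  have hE' : Tendsto (fun i => s i •
      (cliqueTruncation M (sampleCov (y i)) - cliqueTruncation M₀ (sampleCov (y i)))) l (𝓝 0) := by
    refine tendsto_pi_nhds.2 fun a => tendsto_pi_nhds.2 fun b => ?_
    simp only [Matrix.smul_apply, Matrix.sub_apply, cliqueTruncation_apply, smul_eq_mul,
      Matrix.zero_apply]
    by_cases h₀ : b ∈ M₀.part a
    · by_cases h : b ∈ M.part a
      · simp only [h, h₀, if_true, sub_self, mul_zero]
        exact tendsto_const_nhds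
      · exact absurd (part_subset_part hle a h₀) h
    -- Entries in a clique of `M` but across cliques of `M₀` have limit 0, so the rate hypothesis
    -- covers them.
    · have h0 : S₀ a b = 0 := by
        rw [← show cliqueTruncation M₀ S₀ = S₀ from hM₀, cliqueTruncation_apply, if_neg h₀]
      by_cases h : b ∈ M.part a
      · simpa [h, h₀] using hE a b h0
      · simp only [h, h₀, if_false, sub_self, mul_zero]
        exact tendsto_const_nhds
  have hinv : ∀ M : CliqueModel p, Tendsto (fun i => (cliqueTruncation M (sampleCov (y i)))⁻¹) l
      (𝓝 (cliqueTruncation M S₀)⁻¹) := fun M =>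
    tendsto_matrix_inv (((continuous_cliqueTruncation M).tendsto S₀).comp hS)
      (posDef_cliqueTruncation M hS₀).det_pos.ne'
  have h := (continuous_id.matrix_trace.tendsto _).comp
    (((hE'.mul (hinv M)).mul hE').mul (hinv M₀))
  simp only [Matrix.zero_mul, id, Matrix.mul_zero, Matrix.trace_zero] at h
  refine h.congr fun i => ?_
  simp only [Function.comp, Matrix.smul_mul, Matrix.mul_smul, Matrix.trace_smul, smul_eq_mul]
  ring

theorem tendsto_gfdWeight_div_of_lt (N : JacobianNorm) (hn : Tendsto n l atTop)
    (hS₀ : S₀.PosDef) (hS : Tendsto (fun i => sampleCov (y i)) l (𝓝 S₀))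
    (hJ : ∀ c, ∃ δ > 0, ∀ᶠ i in l, δ ≤ jacobianConst N (y i) c)
    (hE : ∀ a b, S₀ a b = 0 →
      Tendsto (fun i => √(n i / Real.log (n i)) * sampleCov (y i) a b) l (𝓝 0))
    {M M₀ : CliqueModel p} (hM₀ : Compatible M₀ S₀) (hlt : M₀ < M) {r : ℕ → ℝ}
    (hr : ∀ n, 0 ≤ r n) {B : ℝ} (hrB : ∀ n, r n ≤ B) :
    Tendsto (fun i => gfdWeight N M (y i) / gfdWeight N M₀ (y i) * r (n i)) l (𝓝 0) := by
  obtain ⟨K, hK, hle⟩ := eventually_gfdWeight_div_le N hn hS hJ M M₀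
  have hα := gammaExponent_lt hlt
  set β := gammaExponent M - gammaExponent M₀ with hβ
  have hβ0 : 0 < β := sub_pos.2 hα
  -- The threshold β/2 lets the likelihood ratio grow at most like x^(β/2), x = n/2, leaving
  -- x^(-β/2) after the gamma factor.
  have htr := (tendsto_trace_remainder hS₀ hS hE hM₀ hlt.le).eventually_le_const
    (show 0 < β / 2 by positivity)
  have h1 : Tendsto (fun x : ℝ => x ^ (-(β / 2))) atTop (𝓝 0) :=
    tendsto_rpow_neg_atTop (by positivity)
  have h2 := ((h1.comp (tendsto_natCast_div_two hn)).const_mul K).mul_const B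
  rw [mul_zero, zero_mul] at h2
  refine squeeze_zero' ?_ ?_ h2
  · filter_upwards [hle] with i hi using mul_nonneg hi.1 (hr _)
  · filter_upwards [hle, htr, eventually_posDef_sampleCov hS₀ hS, hn.eventually_ge_atTop 4]
      with i hi htr hpd hn4
    have hn4' : (4 : ℝ) ≤ n i := by exact_mod_cast hn4
    set x : ℝ := (n i : ℝ) / 2 with hx
    have hx2 : 2 ≤ x := by linarith
    have hx0 : 0 < x := by linarith
    have hA := posDef_cliqueTruncation M hpd
    have hD := posDef_cliqueTruncation M₀ hpd
    have hlog : 0 < Real.log (n i) := Real.log_pos (by linarith)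
    -- Here n ≤ x² because n ≥ 4.
    have hlogx : Real.log (n i) ≤ 2 * Real.log x := by
      rw [← Real.log_rpow hx0 2]
      refine Real.log_le_log (by linarith) ?_
      rw [Real.rpow_two]
      nlinarith
    have hkey := det_cliqueTruncation_div_det_le (M := M₀) hA
    rw [cliqueTruncation_cliqueTruncation_of_le hlt.le] at hkey
    rw [Real.sq_sqrt (by positivity)] at htr
    set T := ((cliqueTruncation M (sampleCov (y i)) - cliqueTruncation M₀ (sampleCov (y i))) *
        (cliqueTruncation M (sampleCov (y i)))⁻¹ *
        (cliqueTruncation M (sampleCov (y i)) - cliqueTruncation M₀ (sampleCov (y i))) *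
        (cliqueTruncation M₀ (sampleCov (y i)))⁻¹).trace
    have hT : T * x ≤ Real.log x * (β / 2) := by
      rw [div_mul_eq_mul_div, div_le_iff₀ hlog] at htr
      have : n i = 2 * x := by rw [hx]; ring
      rw [this] at htr hlogx
      nlinarith
    have h3 : (|(cliqueTruncation M₀ (sampleCov (y i))).det| /
        |(cliqueTruncation M (sampleCov (y i))).det|) ^ x ≤ x ^ (β / 2) := by
      rw [abs_of_pos hA.det_pos, abs_of_pos hD.det_pos]
      refine (Real.rpow_le_rpow (div_pos hD.det_pos hA.det_pos).le hkey hx0.le).trans ?_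
      rw [← Real.exp_mul, Real.rpow_def_of_pos hx0]
      exact Real.exp_le_exp.2 hT
    refine mul_le_mul (hi.2.trans ?_) (hrB _) (hr _) (by simp only [Function.comp]; positivity)
    simp only [Function.comp]
    calc _ ≤ K * x ^ (β / 2) * x ^ (gammaExponent M₀ - gammaExponent M) := by gcongr
      _ = _ := by
        rw [mul_assoc, ← Real.rpow_add hx0]
        congr 2
        rw [hβ]
        ring

theorem eventually_gfdWeight_pos (N : JacobianNorm) (hn : Tendsto n l atTop)
    (hS₀ : S₀.PosDef) (hS : Tendsto (fun i => sampleCov (y i)) l (𝓝 S₀))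
    (hJ : ∀ c, ∃ δ > 0, ∀ᶠ i in l, δ ≤ jacobianConst N (y i) c) (M : CliqueModel p) :
    ∀ᶠ i in l, 0 < gfdWeight N M (y i) := by
  choose δ hδ hJ using hJ
  filter_upwards [(Filter.eventually_all_finset M.parts).2 fun c _ => hJ c,
    eventually_posDef_sampleCov hS₀ hS, hn.eventually_ge_atTop p] with i hi hpd hni
  have hdet := (posDef_cliqueTruncation M hpd).det_pos
  refine mul_pos (div_pos (Real.rpow_pos_of_pos Real.pi_pos _)
    (Real.rpow_pos_of_pos (abs_pos.2 hdet.ne') _)) (Finset.prod_pos fun c hc => ?_)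
  refine mul_pos ((hδ c).trans_le (hi c hc)) (div_pos (multivariateGamma_pos ?_)
    (multivariateGamma_pos le_rfl))
  have : c.card ≤ n i := (Finset.card_le_univ c).trans (by simpa using hni)
  have : (c.card : ℝ) ≤ n i := by exact_mod_cast this
  linarith

/-- Consistency of the penalized generalized fiducial probability along a filter on which the
sample covariances converge, at the rate `√(log n / n)` in the entries where the limit vanishes. -/
theorem tendsto_penalizedGFD (N : JacobianNorm) (hn : Tendsto n l atTop)
    (hS₀ : S₀.PosDef) (hS : Tendsto (fun i => sampleCov (y i)) l (𝓝 S₀))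
    (hJ : ∀ c, ∃ δ > 0, ∀ᶠ i in l, δ ≤ jacobianConst N (y i) c)
    (hE : ∀ a b, S₀ a b = 0 →
      Tendsto (fun i => √(n i / Real.log (n i)) * sampleCov (y i) a b) l (𝓝 0))
    {M₀ : CliqueModel p} (hM₀ : Compatible M₀ S₀) (hmin : ∀ M, Compatible M S₀ → M₀ ≤ M)
    {q : CliqueModel p → ℕ → ℝ} (hq : ∀ M n, 0 ≤ q M n) (hq₀ : ∀ n, 0 < q M₀ n)
    (hincompat : ∀ M : CliqueModel p, ¬ Compatible M S₀ → ∀ a : ℝ, 0 < a →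
      Tendsto (fun n : ℕ => Real.exp (-a * n) * (q M n / q M₀ n)) atTop (𝓝 0))
    (hcompat : ∀ M : CliqueModel p, Compatible M S₀ →
      ∃ B : ℝ, ∀ n : ℕ, q M n / q M₀ n ≤ B) :
    Tendsto (fun i => penalizedGFD N q M₀ (y i)) l (𝓝 1) := by
  classical
  have hw := eventually_gfdWeight_pos N hn hS₀ hS hJ M₀
  have hr : ∀ M n, 0 ≤ q M n / q M₀ n := fun M n => div_nonneg (hq M n) (hq₀ n).le
  have hlim : ∀ M : CliqueModel p, Tendsto (fun i =>
      gfdWeight N M (y i) / gfdWeight N M₀ (y i) * (q M (n i) / q M₀ (n i))) l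
      (𝓝 (if M = M₀ then 1 else 0)) := fun M => by
    split_ifs with h
    · subst h
      refine tendsto_const_nhds.congr' ?_
      filter_upwards [hw] with i hi
      rw [div_self hi.ne', div_self (hq₀ _).ne', one_mul]
    · by_cases hc : Compatible M S₀
      · obtain ⟨B, hB⟩ := hcompat M hc
        exact tendsto_gfdWeight_div_of_lt N hn hS₀ hS hJ hE hM₀
          (lt_of_le_of_ne (hmin M hc) (Ne.symm h)) (hr M) hB
      · exact tendsto_gfdWeight_div_of_not_compatible N hn hS₀ hS hJ hM₀ hc (hr M)
          (hincompat M hc)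
  have hsum := (tendsto_finsetSum Finset.univ fun M _ => hlim M).inv₀ (by simp)
  simp only [Finset.sum_ite_eq', Finset.mem_univ, if_true, inv_one] at hsum
  refine hsum.congr' ?_
  filter_upwards [hw] with i hi
  have hq' := (hq₀ (n i)).ne'
  simp only [penalizedGFD, div_mul_div_comm]
  rw [← Finset.sum_div, inv_div]

end Asymptotics

end CliqueGFD

/-! ### Convergence in probability and sample averages -/

namespace CliqueGFD

section InProbability

variable {Ω : Type*} [MeasurableSpace Ω]

/-- The filter of the sets `A` of pairs `(n, ω)` such that the probability of `(n, ω) ∈ A` tends to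
one; convergence along it is convergence in probability. -/
def inProbability (P : Measure Ω) : Filter (ℕ × Ω) where
  sets := {A | Tendsto (fun n => P {ω | (n, ω) ∉ A}) atTop (𝓝 0)}
  univ_sets := by simp
  sets_of_superset {A B} hA hAB :=
    tendsto_of_tendsto_of_tendsto_of_le_of_le tendsto_const_nhds hA (fun _ => zero_le)
      fun _ => measure_mono fun _ hω h => hω (hAB h)
  inter_sets {A B} hA hB := by
    have h : Tendsto (fun n => P {ω | (n, ω) ∉ A} + P {ω | (n, ω) ∉ B}) atTop (𝓝 0) := by
      simpa using Tendsto.add hA hB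
    refine tendsto_of_tendsto_of_tendsto_of_le_of_le tendsto_const_nhds h (fun _ => zero_le)
      fun n => (measure_mono fun ω hω => ?_).trans (measure_union_le _ _)
    simp only [Set.mem_ofPred_eq, Set.mem_inter_iff, not_and_or] at hω
    exact hω

theorem tendsto_fst_inProbability (P : Measure Ω) : Tendsto Prod.fst (inProbability P) atTop := by
  refine tendsto_atTop.2 fun m => ?_
  refine tendsto_const_nhds.congr' ?_
  filter_upwards [eventually_ge_atTop m] with n hn
  simp [hn]

theorem tendsto_inProbability_iff {P : Measure Ω} {f : ℕ → Ω → ℝ} {c : ℝ} :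
    Tendsto (fun i : ℕ × Ω => f i.1 i.2) (inProbability P) (𝓝 c) ↔
      TendstoInMeasure P f atTop (fun _ => c) := by
  rw [tendstoInMeasure_iff_dist, Metric.tendsto_nhds]
  refine forall₂_congr fun ε _ => ?_
  change Tendsto (fun n => P {ω | ¬ dist (f n ω) c < ε}) atTop (𝓝 0) ↔ _
  simp only [not_lt]

end InProbability

section Sampling

variable {Ω E : Type*} [MeasurableSpace Ω] [MeasurableSpace E] {P : Measure Ω}
  {μ : Measure E} {Y : ℕ → Ω → E} {φ : E → ℝ}

theorem identDistrib_comp (hlaw : ∀ i, HasLaw (Y i) μ P) (hφ : Measurable φ) (i : ℕ) :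
    IdentDistrib (φ ∘ Y i) φ P μ :=
  ((hlaw i).identDistrib HasLaw.id).comp hφ

theorem tendsto_average_inProbability [IsProbabilityMeasure P]
    (hlaw : ∀ i, HasLaw (Y i) μ P) (hindep : iIndepFun Y P)
    (hφ : Measurable φ) (hint : Integrable φ μ) :
    Tendsto (fun i : ℕ × Ω => (∑ k : Fin i.1, φ (Y k i.2)) / (i.1 : ℝ)) (inProbability P)
      (𝓝 (∫ x, φ x ∂μ)) := by
  refine (tendsto_inProbability_iff (f := fun n ω => (∑ k : Fin n, φ (Y k ω)) / (n : ℝ))).2 ?_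
  have hid := identDistrib_comp hlaw hφ
  refine tendstoInMeasure_of_tendsto_ae (fun n => ?_) ?_
  · have h : ∀ k : ℕ, AEStronglyMeasurable (fun ω => φ (Y k ω)) P := fun k =>
      (hid k).aemeasurable_fst.aestronglyMeasurable
    have hs : AEStronglyMeasurable (fun ω => ∑ k : Fin n, φ (Y k ω)) P :=
      Finset.aestronglyMeasurable_fun_sum _ fun k _ => h k
    simpa only [div_eq_mul_inv] using hs.mul_const _
  · have h := strong_law_ae_real (fun i => φ ∘ Y i) ((hid 0).integrable_iff.2 hint)
      (fun i j hij => (hindep.indepFun hij).comp hφ hφ) fun i => (hid i).trans (hid 0).symm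
    rw [(hid 0).integral_eq] at h
    filter_upwards [h] with ω hω
    refine hω.congr fun n => ?_
    rw [Finset.sum_range]
    rfl

theorem tendsto_rate_mul_average_inProbability [IsProbabilityMeasure P]
    (hlaw : ∀ i, HasLaw (Y i) μ P)
    (hindep : iIndepFun Y P) (hφ : Measurable φ) (hL2 : MemLp φ 2 μ) (h0 : ∫ x, φ x ∂μ = 0) :
    Tendsto (fun i : ℕ × Ω => √(i.1 / Real.log i.1) * ((∑ k : Fin i.1, φ (Y k i.2)) / (i.1 : ℝ)))
      (inProbability P) (𝓝 0) := by
  refine (tendsto_inProbability_iff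
    (f := fun n ω => √(n / Real.log n) * ((∑ k : Fin n, φ (Y k ω)) / (n : ℝ)))).2 ?_
  rw [tendstoInMeasure_iff_norm]
  intro ε hε
  have hid := identDistrib_comp hlaw hφ
  have hmem : ∀ k, MemLp (φ ∘ Y k) 2 P := fun k => (hid k).memLp_iff.2 hL2
  set V := Var[φ; μ] with hV
  have hlim : Tendsto (fun n : ℕ => ENNReal.ofReal (V / ε ^ 2 / Real.log n)) atTop (𝓝 0) := by
    have h : Tendsto (fun n : ℕ => V / ε ^ 2 / Real.log n) atTop (𝓝 0) :=
      tendsto_const_nhds.div_atTop (Real.tendsto_log_atTop.comp tendsto_natCast_atTop_atTop)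
    simpa using ENNReal.tendsto_ofReal h
  refine tendsto_of_tendsto_of_tendsto_of_le_of_le' tendsto_const_nhds hlim
    (Eventually.of_forall fun _ => zero_le) ?_
  filter_upwards [eventually_ge_atTop 2] with n hn
  have hn' : (2 : ℝ) ≤ n := by exact_mod_cast hn
  have hn0 : (0 : ℝ) < n := by linarith
  have hlog : 0 < Real.log n := Real.log_pos (by linarith)
  set T : Ω → ℝ := ∑ k ∈ Finset.range n, φ ∘ Y k with hT
  have hTmem : MemLp T 2 P := memLp_finsetSum' _ fun k _ => hmem k
  have hTmean : ∫ ω, T ω ∂P = 0 := by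
    simp only [hT, Finset.sum_apply]
    rw [integral_finsetSum _ fun k _ => (hmem k).integrable (by norm_num)]
    exact Finset.sum_eq_zero fun k _ => (hid k).integral_eq.trans h0
  have hTvar : Var[T; P] = n * V := by
    rw [hT, IndepFun.variance_sum (fun k _ => hmem k)
      fun i _ j _ hij => (hindep.indepFun hij).comp hφ hφ]
    simp [fun k => (hid k).variance_eq, hV]
  -- The sum has variance nV, so at level ε√(n log n) Chebyshev leaves V/(ε² log n). The rate √(n /
  -- log n) matches this level because √(n / log n) · √(n log n) = n.
  have hcheb := meas_ge_le_variance_div_sq hTmem (c := ε * √(n * Real.log n)) (by positivity)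
  rw [hTmean, hTvar, mul_pow, Real.sq_sqrt (by positivity)] at hcheb
  rw [show (n : ℝ) * V / (ε ^ 2 * (n * Real.log n)) = V / ε ^ 2 / Real.log n by
    field_simp] at hcheb
  refine (measure_mono fun ω hω => ?_).trans hcheb
  simp only [Set.mem_ofPred_eq, sub_zero, Real.norm_eq_abs] at hω ⊢
  have hsum : ∑ k : Fin n, φ (Y k ω) = T ω := by
    rw [hT, Finset.sum_apply, Finset.sum_range]
    rfl
  rw [hsum, abs_mul, abs_of_nonneg (Real.sqrt_nonneg _), abs_div, abs_of_pos hn0] at hω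
  have hs : √(n / Real.log n) * √(n * Real.log n) = n := by
    rw [← Real.sqrt_mul (by positivity),
      show (n : ℝ) / Real.log n * (n * Real.log n) = n ^ 2 by field_simp, Real.sqrt_sq hn0.le]
  have hs0 : 0 < √(n / Real.log n) := by positivity
  rw [← mul_le_mul_iff_right₀ hs0]
  calc √(n / Real.log n) * (ε * √(n * Real.log n)) = n * ε := by
        rw [mul_left_comm, hs, mul_comm]
    _ ≤ n * (√(n / Real.log n) * (|T ω| / n)) := by gcongr
    _ = _ := by field_simp

end Sampling

/-! ### Gaussian moments and the lower bound for the Jacobian -/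

variable {p : ℕ} {S₀ : Matrix (Fin p) (Fin p) ℝ}

theorem memLp_eval_multivariateGaussian (a : Fin p) (r : ENNReal) (hr : r ≠ ⊤) :
    MemLp (fun x : EuclideanSpace ℝ (Fin p) => x a) r (multivariateGaussian 0 S₀) :=
  (IsGaussian.memLp_id (multivariateGaussian 0 S₀) r hr).eval_piLp a

theorem memLp_mul_eval_multivariateGaussian (a b : Fin p) :
    MemLp (fun x : EuclideanSpace ℝ (Fin p) => x a * x b) 2 (multivariateGaussian 0 S₀) := by
  have : ENNReal.HolderTriple 4 4 2 := ⟨by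
    rw [← ENNReal.toReal_eq_toReal_iff' (by simp) (by simp), ENNReal.toReal_add (by simp) (by simp)]
    norm_num⟩
  exact (memLp_eval_multivariateGaussian b 4 (by simp)).mul
    (memLp_eval_multivariateGaussian a 4 (by simp))

theorem integral_mul_eval_multivariateGaussian (hS₀ : S₀.PosSemidef) (a b : Fin p) :
    ∫ x, x a * x b ∂(multivariateGaussian 0 S₀) = S₀ a b := by
  have h0 : ∀ a : Fin p, ∫ x, x a ∂(multivariateGaussian 0 S₀) = 0 := fun a => by
    have h := (EuclideanSpace.proj (𝕜 := ℝ) a).integral_comp_comm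
      (IsGaussian.integrable_id (μ := multivariateGaussian 0 S₀))
    simpa using h
  have h := covariance_eq_sub (memLp_eval_multivariateGaussian (S₀ := S₀) a 2 (by simp))
    (memLp_eval_multivariateGaussian b 2 (by simp))
  rw [covariance_eval_multivariateGaussian hS₀, h0, zero_mul, sub_zero] at h
  exact h.symm

/-- The second moment matrix of a centred Gaussian vector shrunk into the unit ball. -/
noncomputable def shrunkCov (S₀ : Matrix (Fin p) (Fin p) ℝ) : Matrix (Fin p) (Fin p) ℝ :=
  Matrix.of fun a b => ∫ x : EuclideanSpace ℝ (Fin p),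
    (1 + ‖x‖)⁻¹ * x a * ((1 + ‖x‖)⁻¹ * x b) ∂(multivariateGaussian 0 S₀)

theorem abs_shrink_le_one (x : EuclideanSpace ℝ (Fin p)) (a : Fin p) :
    |(1 + ‖x‖)⁻¹ * x a| ≤ 1 := by
  have h : |x a| ≤ ‖x‖ := PiLp.norm_apply_le x a
  have h0 := norm_nonneg x
  rw [abs_mul, abs_of_nonneg (by positivity), inv_mul_le_iff₀ (by positivity)]
  linarith

theorem measurable_shrink (a : Fin p) :
    Measurable fun x : EuclideanSpace ℝ (Fin p) => (1 + ‖x‖)⁻¹ * x a := by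
  fun_prop

theorem integrable_shrink_mul_shrink (a b : Fin p) :
    Integrable (fun x : EuclideanSpace ℝ (Fin p) => (1 + ‖x‖)⁻¹ * x a * ((1 + ‖x‖)⁻¹ * x b))
      (multivariateGaussian 0 S₀) := by
  refine Integrable.of_bound (C := 1)
    ((measurable_shrink a).mul (measurable_shrink b)).aestronglyMeasurable
    (Eventually.of_forall fun x => ?_)
  rw [norm_mul]
  exact mul_le_one₀ (abs_shrink_le_one x a) (norm_nonneg _) (abs_shrink_le_one x b)

/-- Its quadratic form integrates (1 + ‖x‖)⁻²(v·x)², which has the same support as (v·x)². The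
latter has integral vᵀS₀v > 0, so this support has positive measure; no density is needed. -/
theorem posDef_shrunkCov (hS₀ : S₀.PosDef) : (shrunkCov S₀).PosDef := by
  refine Matrix.PosDef.of_dotProduct_mulVec_pos ?_ fun v hv => ?_
  · ext a b
    simp [shrunkCov, mul_comm]
  · set μ := multivariateGaussian (0 : EuclideanSpace ℝ (Fin p)) S₀
    have hquad : ∀ f : Fin p → EuclideanSpace ℝ (Fin p) → ℝ,
        (∀ a b, Integrable (fun x => f a x * f b x) μ) →
        star v ⬝ᵥ (Matrix.of fun a b => ∫ x, f a x * f b x ∂μ).mulVec v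
          = ∫ x, (∑ a, v a * f a x) ^ 2 ∂μ ∧ Integrable (fun x => (∑ a, v a * f a x) ^ 2) μ :=
        fun f hf => by
      have e : ∀ x, (∑ a, v a * f a x) ^ 2 = ∑ a, ∑ b, v a * v b * (f a x * f b x) := fun x => by
        rw [sq, Finset.sum_mul_sum]
        exact Finset.sum_congr rfl fun a _ => Finset.sum_congr rfl fun b _ => by ring
      have hi : ∀ a b, Integrable (fun x => v a * v b * (f a x * f b x)) μ := fun a b =>
        (hf a b).const_mul _
      simp only [e]
      refine ⟨?_, integrable_finsetSum _ fun a _ => integrable_finsetSum _ fun b _ => hi a b⟩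
      rw [integral_finsetSum _ fun a _ => integrable_finsetSum _ fun b _ => hi a b]
      simp only [dotProduct, Matrix.mulVec, Finset.mul_sum, star_trivial, Pi.star_apply]
      refine Finset.sum_congr rfl fun a _ => ?_
      rw [integral_finsetSum _ fun b _ => hi a b]
      refine Finset.sum_congr rfl fun b _ => ?_
      rw [integral_const_mul, Matrix.of_apply]
      ring
    obtain ⟨h1, h1i⟩ := hquad _ fun a b => integrable_shrink_mul_shrink (S₀ := S₀) a b
    obtain ⟨h2, h2i⟩ := hquad (fun a x => x a) fun a b =>
      (memLp_mul_eval_multivariateGaussian (S₀ := S₀) a b).integrable (by norm_num)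
    simp only [μ, integral_mul_eval_multivariateGaussian hS₀.posSemidef] at h2
    have h2' : 0 < ∫ x, (∑ a, v a * x a) ^ 2 ∂μ := by
      rw [← h2]
      exact hS₀.dotProduct_mulVec_pos hv
    have e : ∀ x : EuclideanSpace ℝ (Fin p), (∑ a, v a * ((1 + ‖x‖)⁻¹ * x a)) ^ 2
        = ((1 + ‖x‖)⁻¹) ^ 2 * (∑ a, v a * x a) ^ 2 := fun x => by
      rw [← mul_pow, Finset.mul_sum]
      congr 1
      exact Finset.sum_congr rfl fun a _ => by ring
    have h3 : star v ⬝ᵥ (shrunkCov S₀).mulVec v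
        = ∫ x : EuclideanSpace ℝ (Fin p), (∑ a, v a * ((1 + ‖x‖)⁻¹ * x a)) ^ 2 ∂μ := h1
    rw [h3]
    rw [integral_pos_iff_support_of_nonneg (fun x => sq_nonneg _) h2i] at h2'
    rw [integral_pos_iff_support_of_nonneg (fun x => sq_nonneg _) h1i]
    refine h2'.trans_le (measure_mono fun x hx => ?_)
    simp only [Function.mem_support] at hx ⊢
    rw [e]
    exact mul_ne_zero (by positivity) hx

theorem tendsto_matrix_of_elem {ι κ : Type*} {l : Filter ι} {A : ι → Matrix κ κ ℝ}
    {A₀ : Matrix κ κ ℝ} (h : ∀ a b, Tendsto (fun i => A i a b) l (𝓝 (A₀ a b))) :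
    Tendsto A l (𝓝 A₀) :=
  tendsto_pi_nhds.2 fun a => tendsto_pi_nhds.2 fun b => h a b

theorem eventually_le_jacobianConst_inProbability (N : JacobianNorm) {Ω : Type*}
    [MeasurableSpace Ω] {P : Measure Ω} [IsProbabilityMeasure P]
    {Y : ℕ → Ω → EuclideanSpace ℝ (Fin p)} (hS₀ : S₀.PosDef)
    (hlaw : ∀ i, HasLaw (Y i) (multivariateGaussian 0 S₀) P) (hindep : iIndepFun Y P)
    (hS : Tendsto (fun i : ℕ × Ω => sampleCov (dataMatrix Y i.1 i.2)) (inProbability P) (𝓝 S₀))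
    (c : Finset (Fin p)) :
    ∃ δ > 0, ∀ᶠ i in inProbability P, δ ≤ jacobianConst N (dataMatrix Y i.1 i.2) c := by
  have hpos : ∀ {A : Matrix (Fin p) (Fin p) ℝ}, A.PosDef → 0 < (cliqueBlock c A).det :=
    fun hA => (hA.submatrix Subtype.val_injective).det_pos
  cases N with
  | l2 =>
    have h0 : 0 < |(cliqueBlock c S₀).det| ^ ((c.card : ℝ) / 2) :=
      Real.rpow_pos_of_pos (abs_pos.2 (hpos hS₀).ne') _
    exact ⟨_, half_pos h0, (tendsto_jacobianConst_l2 c hS).eventually_const_le (half_lt_self h0)⟩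
  | linf =>
    have hz : Tendsto (fun i : ℕ × Ω => sampleCov (Matrix.of fun (k : Fin i.1) a =>
        (1 + ‖Y k i.2‖)⁻¹ * dataMatrix Y i.1 i.2 k a)) (inProbability P) (𝓝 (shrunkCov S₀)) := by
      refine tendsto_matrix_of_elem fun a b => ?_
      have h := tendsto_average_inProbability
        (φ := fun x : EuclideanSpace ℝ (Fin p) => (1 + ‖x‖)⁻¹ * x a * ((1 + ‖x‖)⁻¹ * x b)) hlaw
        hindep ((measurable_shrink a).mul (measurable_shrink b)) (integrable_shrink_mul_shrink a b)
      simpa only [sampleCov, dataMatrix, shrunkCov, Matrix.of_apply] using h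
    have hdet := ((continuous_cliqueBlock c).matrix_det.tendsto _).comp hz
    have h0 := hpos (posDef_shrunkCov hS₀)
    refine ⟨((cliqueBlock c (shrunkCov S₀)).det / 2) ^ c.card, by positivity, ?_⟩
    -- The bound `c.card + 1` ensures n > 0 also for empty `c`.
    filter_upwards [hdet.eventually_const_le (half_lt_self h0),
      (tendsto_fst_inProbability P).eventually_ge_atTop (c.card + 1)] with i h1 h2
    refine pow_le_pow_left₀ (by positivity) (h1.trans ?_) _
    exact det_cliqueBlock_le_averageAbsDet _ c (by omega) (by omega) _ (fun k => by positivity)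
      (fun k => inv_le_one_of_one_le₀ (by linarith [norm_nonneg (Y k i.2)]))
      fun k a => abs_shrink_le_one (Y k i.2) a

end CliqueGFD

/-! ### Consistency in probability -/

theorem theorem2 (N : CliqueGFD.JacobianNorm) (p : ℕ)
    {Ω : Type*} [MeasurableSpace Ω] (P : Measure Ω) [IsProbabilityMeasure P]
    (S₀ : Matrix (Fin p) (Fin p) ℝ) (hS₀ : S₀.PosDef)
    (Y : ℕ → Ω → EuclideanSpace ℝ (Fin p))
    (hlaw : ∀ i, HasLaw (Y i) (multivariateGaussian 0 S₀) P)
    (hindep : iIndepFun Y P)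
    (M₀ : CliqueGFD.CliqueModel p)
    (hM₀ : CliqueGFD.Compatible M₀ S₀)
    (hmin : ∀ M : CliqueGFD.CliqueModel p, CliqueGFD.Compatible M S₀ → M₀ ≤ M)
    (q : CliqueGFD.CliqueModel p → ℕ → ℝ)
    (hq : ∀ M n, 0 ≤ q M n) (hq₀ : ∀ n, 0 < q M₀ n)
    (hincompat : ∀ M : CliqueGFD.CliqueModel p, ¬ CliqueGFD.Compatible M S₀ →
      ∀ a : ℝ, 0 < a →
        Tendsto (fun n : ℕ => Real.exp (-a * n) * (q M n / q M₀ n)) atTop (𝓝 0))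
    (hcompat : ∀ M : CliqueGFD.CliqueModel p, CliqueGFD.Compatible M S₀ →
      ∃ B : ℝ, ∀ n : ℕ, q M n / q M₀ n ≤ B) :
    TendstoInMeasure P
      (fun (n : ℕ) (ω : Ω) => CliqueGFD.penalizedGFD N q M₀ (CliqueGFD.dataMatrix Y n ω))
      atTop (fun _ => 1) := by
  have hmeas : ∀ a b : Fin p, Measurable fun x : EuclideanSpace ℝ (Fin p) => x a * x b :=
    fun a b => by fun_prop
  have hL2 := CliqueGFD.memLp_mul_eval_multivariateGaussian (S₀ := S₀)
  have hint := CliqueGFD.integral_mul_eval_multivariateGaussian hS₀.posSemidef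
  have hS : Tendsto (fun i : ℕ × Ω => CliqueGFD.sampleCov (CliqueGFD.dataMatrix Y i.1 i.2))
      (CliqueGFD.inProbability P) (𝓝 S₀) := by
    refine CliqueGFD.tendsto_matrix_of_elem fun a b => ?_
    rw [← hint a b]
    have h := CliqueGFD.tendsto_average_inProbability hlaw hindep (hmeas a b)
      ((hL2 a b).integrable (by norm_num))
    simpa only [CliqueGFD.sampleCov, CliqueGFD.dataMatrix, Matrix.of_apply] using h
  refine CliqueGFD.tendsto_inProbability_iff.1 ?_
  refine CliqueGFD.tendsto_penalizedGFD (y := fun i : ℕ × Ω => CliqueGFD.dataMatrix Y i.1 i.2) N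
    (CliqueGFD.tendsto_fst_inProbability P) hS₀ hS
    (CliqueGFD.eventually_le_jacobianConst_inProbability N hS₀ hlaw hindep hS)
    (fun a b hab => ?_) hM₀ hmin hq hq₀ hincompat hcompat
  -- Where S₀ vanishes, the product of the two coordinates is centred and square integrable.
  have h := CliqueGFD.tendsto_rate_mul_average_inProbability hlaw hindep (hmeas a b) (hL2 a b)
    ((hint a b).trans hab)
  simpa only [CliqueGFD.sampleCov, CliqueGFD.dataMatrix, Matrix.of_apply] using h
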